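/- Let $X$ be a real separable Hilbert space. Let $\{U(t,s)\}_{s\le t}\subseteq\mathscr L(X)$ and $\{B(t)\}_{t\in\mathbb R}\subseteq\mathscr L(X)$ satisfy: (i) for every $x\in X$ the map $(s,t)\mapsto U(t,s)x$ is continuous on $\{s\le t\}$, $U(t,t)=I$, and $U(t,r)U(r,s)=U(t,s)$ for $s\le r\le t$; (ii) $\sup_t\|B(t)\|<\infty$ and $t\mapsto B(t)x$ is (Lebesgue) measurable for every $x\in X$; (iii) for $s<t$ the nonnegative operator $Q(t,s)=\int_s^tU(t,r)B(r)B(r)^\star U(t,r)^\star\,dr$ (strong integral) has finite trace; (iv) for every $t$, $\sup_{s<t}\mathrm{Tr}\,Q(t,s)<\infty$, and $\lim_{s\to-\infty}U(t,s)x=0$ for every $x\in X$. Let $\mathcal N(a,Q)$ be the Gaussian measure with mean $a$ and covariance operator $Q$. Put $P_{t,t}=I$ and $(P_{s,t}\varphi)(x)=\int_X\varphi\,d\mathcal N(U(t,s)x,Q(t,s))$ for $s<t$; put $Q(t,-\infty)=\int_{-\infty}^tU(t,r)B(r)B(r)^\star U(t,r)^\star\,dr$, $\gamma_t=\mathcal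 N(0,Q(t,-\infty))$, and let $\mathcal H_t=Q(t,-\infty)^{1/2}(X)$, with $\langle h,k\rangle_{\mathcal H_t}=\langle Q(t,-\infty)^{-1/2}h,Q(t,-\infty)^{-1/2}k\rangle_X$ (pseudo-inverse), be the Cameron–Martin space of $\gamma_t$. For centered Gaussian measures $\mu=\mathcal N(0,Q_\mu)$, $\nu=\mathcal N(0,Q_\nu)$ on $X$ with Cameron–Martin spaces $H_\mu,H_\nu$, and $T\in\mathscr L(H_\mu,H_\nu)$, let $T_\infty\in L^2(X,\mu;X)$ be the limit in $L^2(X,\mu;X)$ of the operators $x\mapsto\sum_{i\in J}\lambda_i^{-1/2}\langle Q_\mu^{-1/2}e_i,x\rangle_X\,Te_i$ as the finite set $J$ increases, where $(e_i)$ is an orthonormal basis of $H_\mu$ with $Q_\mu e_i=\lambda_ie_i$. A linear version of $T_\infty$ is a linear map $X\to X$, measurable with respect to the $\mu$-completed Borel $\sigma$-algebra, that is $\mu$-a.e. equal to $T_\infty$. If $\|T\|\le1$, $F$ is a linear version of $(T^\star)_\infty$ and $G$ is a linear version of $((I-T^\star T)^{1/2})_\infty$, set $$(\Gamma^{F,G}_{\nu,\mu}(T)f)(x)=\int_Xf(Fx+Gy)\,\mu(dy),\qquad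 x\in X,$$ for every Borel function $f$ of at most exponential growth. The second quantization operator $\Gamma_{\nu,\mu}(T)$ is $\Gamma^{F,G}_{\nu,\mu}(T)$ for the following choice of versions $F$ and $G$: if the operator in question ($T^\star$, respectively $(I-T^\star T)^{1/2}$) extends to a bounded operator on the closure in $X$ of its Cameron–Martin space, this bounded extension, continued by $0$ on the orthogonal complement, is used; otherwise some fixed linear version is used. Then all these objects are well defined: the strong integrals $Q(t,s)$ and $Q(t,-\infty)$ converge, the Gaussian measures $\mathcal N(U(t,s)x,Q(t,s))$ and $\gamma_t$ exist, and $\{\gamma_t\}$ is an evolution system of measures, i.e. $\int_XP_{s,t}\varphi\,d\gamma_s=\int_X\varphi\,d\gamma_t$ for all $s\le t$ and $\varphi\in C_b(X)$. For every $s\le t$, $U(t,s)$ maps $\mathcal H_s$ into $\mathcal H_t$, the restriction $U(t,s)_{|\mathcal H_s}\colon\mathcal H_s\to\mathcal H_t$ is bounded, and $L:=(U(t,s)_{|\mathcal H_s})^\star\in\mathscr L(\mathcal H_t,\mathcal H_s)$ satisfies $\|L\|\le1$. Moreover: (a) for every bounded Borel $f\colon X\to\mathbb R$, $P_{s,t}f=\Gamma_{\gamma_s,\gamma_t}(L)f$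 holds $\gamma_s$-almost everywhere, and at every point of the closure of $\mathcal H_s$ in $X$; (b) $U(t,s)$ is a linear version of $(L^\star)_\infty$, and the versions chosen in the definition of $\Gamma_{\gamma_s,\gamma_t}(L)$ are indeed linear versions. For all linear versions $F$ of $(L^\star)_\infty$ and $G$ of $((I-L^\star L)^{1/2})_\infty$ and every bounded Borel $f$, $P_{s,t}f=\Gamma^{F,G}_{\gamma_s,\gamma_t}(L)f$ holds $\gamma_s$-almost everywhere and at every $x$ with $Fx=U(t,s)x$; in particular it holds at every $x\in X$ if $F=U(t,s)$; (c) for every $p\in[1,\infty)$, $P_{s,t}$ (on bounded Borel functions) and $\Gamma_{\gamma_s,\gamma_t}(L)$ (on Borel functions of at most exponential growth) have unique bounded linear extensions $L^p(X,\gamma_t)\to L^p(X,\gamma_s)$, and these two extensions coincide. -/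

import Mathlib

open MeasureTheory ProbabilityTheory Filter Topology Set
open scoped ENNReal RealInnerProductSpace

noncomputable section

namespace OUEvolution

universe u

/-! ### Square roots, ranges with their Hilbert structure, traces -/

section Operators

variable {E : Type u} [NormedAddCommGroup E] [InnerProductSpace ℝ E] [CompleteSpace E]

open Classical in
/-- The nonnegative square root `A ^ (1/2)` of a nonnegative self-adjoint operator `A`: the (unique)
nonnegative self-adjoint `R` with `R ∘ R = A`. (Value `0` when `A` has no such root.) -/
def posSqrt (A : E →L[ℝ] E) : E →L[ℝ] E :=
  if h : ∃ R : E →L[ℝ] E, R.IsPositive ∧ R ∘L R = A then h.choose else 0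

/-- The range `R(E)` of `R`. It is given below the Hilbert structure
`⟪x, y⟫ = ⟪R⁻¹ x, R⁻¹ y⟫_E`, where `R⁻¹` is the pseudo-inverse of `R` (and not the one
inherited from `E`). -/
def RangeSpace (R : E →L[ℝ] E) : Type u := LinearMap.range (R : E →ₗ[ℝ] E)

namespace RangeSpace

variable (R : E →L[ℝ] E)

instance : AddCommGroup (RangeSpace R) :=
  inferInstanceAs (AddCommGroup (LinearMap.range (R : E →ₗ[ℝ] E)))

instance : Module ℝ (RangeSpace R) :=
  inferInstanceAs (Module ℝ (LinearMap.range (R : E →ₗ[ℝ] E)))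

/-- The inclusion of `R(E)` in `E`. -/
def incl : RangeSpace R →ₗ[ℝ] E := (LinearMap.range (R : E →ₗ[ℝ] E)).subtype

theorem isCompl_ker :
    IsCompl (LinearMap.ker (R : E →ₗ[ℝ] E))ᗮ (LinearMap.ker (R : E →ₗ[ℝ] E)) := by
  have hcl : IsClosed ((LinearMap.ker (R : E →ₗ[ℝ] E) : Submodule ℝ E) : Set E) :=
    R.isClosed_ker
  have : CompleteSpace (LinearMap.ker (R : E →ₗ[ℝ] E)) := hcl.completeSpace_coe
  exact (Submodule.isCompl_orthogonal _).symm

/-- The bijection `(ker R)ᗮ → R(E)` induced by `R`. -/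
def equivRange : ((LinearMap.ker (R : E →ₗ[ℝ] E))ᗮ : Submodule ℝ E) ≃ₗ[ℝ] RangeSpace R :=
  LinearMap.kerComplementEquivRange (R : E →ₗ[ℝ] E) (isCompl_ker R)

/-- The pseudo-inverse `R⁻¹ : R(E) → E`; `R⁻¹ y` is the unique `x ∈ (ker R)ᗮ` with `R x = y`. -/
def pinv : RangeSpace R →ₗ[ℝ] E :=
  ((LinearMap.ker (R : E →ₗ[ℝ] E))ᗮ).subtype ∘ₗ
    ((equivRange R).symm : RangeSpace R →ₗ[ℝ] ((LinearMap.ker (R : E →ₗ[ℝ] E))ᗮ : Submodule ℝ E))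

theorem pinv_mem (y : RangeSpace R) : pinv R y ∈ (LinearMap.ker (R : E →ₗ[ℝ] E))ᗮ :=
  ((equivRange R).symm y).2

theorem apply_pinv (y : RangeSpace R) : R (pinv R y) = incl R y := by
  have h := (equivRange R).apply_symm_apply y
  have h2 := congrArg (incl R) h
  rw [← h2]
  rfl

theorem pinv_injective : Function.Injective (pinv R) := fun _ _ h =>
  (equivRange R).symm.injective (Subtype.ext h)

instance : NormedAddCommGroup (RangeSpace R) :=
  NormedAddCommGroup.induced (RangeSpace R) E (pinv R) (pinv_injective R)

instance : InnerProductSpace ℝ (RangeSpace R) where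
  norm_smul_le c x := by
    change ‖pinv R (c • x)‖ ≤ ‖c‖ * ‖pinv R x‖
    rw [map_smul, norm_smul]
  inner x y := ⟪pinv R x, pinv R y⟫
  norm_sq_eq_re_inner x := norm_sq_eq_re_inner (𝕜 := ℝ) (pinv R x)
  conj_inner_symm x y := inner_conj_symm (𝕜 := ℝ) (pinv R x) (pinv R y)
  add_left x y z := by
    change ⟪pinv R (x + y), pinv R z⟫ = ⟪pinv R x, pinv R z⟫ + ⟪pinv R y, pinv R z⟫
    rw [map_add, inner_add_left]
  smul_left x y r := by
    change ⟪pinv R (r • x), pinv R y⟫ = _ * ⟪pinv R x, pinv R y⟫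
    rw [map_smul, inner_smul_left]

theorem inner_def (x y : RangeSpace R) : ⟪x, y⟫ = ⟪pinv R x, pinv R y⟫ := rfl

theorem norm_def (x : RangeSpace R) : ‖x‖ = ‖pinv R x‖ := rfl

/-- `(ker R)ᗮ` and `R(E)` are isometric. -/
def isometryEquiv : RangeSpace R ≃ₗᵢ[ℝ] ((LinearMap.ker (R : E →ₗ[ℝ] E))ᗮ : Submodule ℝ E) where
  toLinearEquiv := (equivRange R).symm
  norm_map' _ := rfl

instance : CompleteSpace (RangeSpace R) :=
  (isometryEquiv R).toIsometryEquiv.completeSpace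

end RangeSpace

/-- The Cameron–Martin space `Q ^ (1/2) (E)` of the Gaussian measure `N(0, Q)`, with inner product
`⟪Q ^ (-1/2) x, Q ^ (-1/2) y⟫_E`. -/
abbrev CameronMartin (Q : E →L[ℝ] E) : Type u := RangeSpace (posSqrt Q)

/-- The inclusion of the Cameron–Martin space in the ambient space. -/
abbrev cmIncl (Q : E →L[ℝ] E) : CameronMartin Q →ₗ[ℝ] E := RangeSpace.incl (posSqrt Q)

/-- The pseudo-inverse `Q ^ (-1/2)` of `Q ^ (1/2)`, on the Cameron–Martin space. -/
abbrev cmPinv (Q : E →L[ℝ] E) : CameronMartin Q →ₗ[ℝ] E := RangeSpace.pinv (posSqrt Q)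

variable (E) in
/-- The index set of an orthonormal basis of `E`. -/
def basisSet : Set E := (exists_hilbertBasis ℝ E).choose

variable (E) in
/-- An orthonormal basis of `E`. -/
def basis : HilbertBasis (basisSet E) ℝ E := (exists_hilbertBasis ℝ E).choose_spec.choose

/-- The trace `∑ ⟪Q eᵢ, eᵢ⟫ ∈ [0, ∞]` of a nonnegative self-adjoint operator `Q`, computed in an
orthonormal basis (its value does not depend on the basis). -/
def posTrace (Q : E →L[ℝ] E) : ℝ≥0∞ := ∑' i, ENNReal.ofReal ⟪Q (basis E i), basis E i⟫

/-- `S x = ∫ A(r) x dρ(r)` for every `x`, as convergent Bochner integrals. -/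
def IsStrongIntegral (ρ : Measure ℝ) (A : ℝ → E →L[ℝ] E) (S : E →L[ℝ] E) : Prop :=
  ∀ x, Integrable (fun r => A r x) ρ ∧ S x = ∫ r, A r x ∂ρ

open Classical in
/-- The operator `∫ A(r) dρ(r)`, the integral being taken in the strong sense.
(Value `0` when there is no such operator.) -/
def strongIntegral (ρ : Measure ℝ) (A : ℝ → E →L[ℝ] E) : E →L[ℝ] E :=
  if h : ∃ S, IsStrongIntegral ρ A S then h.choose else 0

end Operators

/-! ### Gaussian measures -/

section Gaussian

variable {X : Type u} [NormedAddCommGroup X] [InnerProductSpace ℝ X] [CompleteSpace X]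
  [MeasurableSpace X] [BorelSpace X]

/-- `μ` is a Gaussian measure with mean `a` and covariance operator `Q`. -/
def IsGaussianWith (μ : Measure X) (a : X) (Q : X →L[ℝ] X) : Prop :=
  IsGaussian μ ∧ ∫ x, x ∂μ = a ∧ ∀ x y, covarianceBilin μ x y = ⟪Q x, y⟫

open Classical in
/-- The Gaussian measure `N(a, Q)`, that is the unique Gaussian measure with mean `a` and covariance
operator `Q`. (Value `0` when there is none.) -/
def gaussianMeasure (a : X) (Q : X →L[ℝ] X) : Measure X :=
  if h : ∃ μ : Measure X, IsGaussianWith μ a Q then h.choose else 0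

/-! ### Measurable linear extensions and second quantization

In this part `Qμ`, `Qν` are the covariance operators of `μ = N(0, Qμ)`, `ν = N(0, Qν)`. -/

/-- For an orthonormal basis `e` of `H_μ` with `Qμ eᵢ = λᵢ eᵢ` and a finite set `J` of indices:
the operator `x ↦ T (π_J x)`, where `π_J x = ∑_{i ∈ J} λᵢ ^ (-1/2) ⟪Qμ ^ (-1/2) eᵢ, x⟫ eᵢ`. -/
def finiteApprox {Qμ Qν : X →L[ℝ] X} (T : CameronMartin Qμ →L[ℝ] CameronMartin Qν)
    {ι : Type u} (e : ι → CameronMartin Qμ) (lam : ι → ℝ) (J : Finset ι) (x : X) : X :=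
  ∑ i ∈ J, (⟪cmPinv Qμ (e i), x⟫ / √(lam i)) • cmIncl Qν (T (e i))

/-- `F` is a linear version of the extension `T_∞ : X → X` of `T : H_μ → H_ν`: it is linear,
measurable for the `μ`-completion of the Borel sets, and it is `μ`-almost everywhere equal to the
limit in `L²(X, μ; X)` of the operators `T π_J`, along an orthonormal basis of `H_μ` made of
eigenvectors of `Qμ`. -/
def IsLinearVersion {Qμ Qν : X →L[ℝ] X} (T : CameronMartin Qμ →L[ℝ] CameronMartin Qν)
    (F : X →ₗ[ℝ] X) : Prop :=
  AEMeasurable F (gaussianMeasure 0 Qμ) ∧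
  ∃ (w : Set (CameronMartin Qμ)) (e : HilbertBasis w ℝ (CameronMartin Qμ)) (lam : w → ℝ),
    (∀ i, Qμ (cmIncl Qμ (e i)) = lam i • cmIncl Qμ (e i)) ∧
    Tendsto (fun J : Finset w =>
      eLpNorm (fun x => F x - finiteApprox T e lam J x) 2 (gaussianMeasure 0 Qμ)) atTop (𝓝 0)

/-- `A` extends `T : H_μ → H_ν` to a bounded operator on `X` that vanishes on `ker (Qμ ^ (1/2))`,
the orthogonal complement of the closure of `H_μ`. -/
def IsBoundedExtension {Qμ Qν : X →L[ℝ] X} (T : CameronMartin Qμ →L[ℝ] CameronMartin Qν)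
    (A : X →L[ℝ] X) : Prop :=
  (∀ h, A (cmIncl Qμ h) = cmIncl Qν (T h)) ∧ ∀ x, posSqrt Qμ x = 0 → A x = 0

open Classical in
/-- The extension `T_∞` of `T : H_μ → H_ν` to `X`, as an everywhere defined linear map: if `T` extends
to a bounded operator on the closure of `H_μ`, this bounded extension, continued by `0` on the
orthogonal complement; otherwise some linear version of `T_∞`. -/
def infExt {Qμ Qν : X →L[ℝ] X} (T : CameronMartin Qμ →L[ℝ] CameronMartin Qν) : X →ₗ[ℝ] X :=
  if h : ∃ A : X →L[ℝ] X, IsBoundedExtension T A then (h.choose : X →ₗ[ℝ] X)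
  else if h' : ∃ F : X →ₗ[ℝ] X, IsLinearVersion T F then h'.choose else 0

/-- The operator `(I - T⋆ T) ^ (1/2)` on `H_μ`. -/
def defect {Qμ Qν : X →L[ℝ] X} (T : CameronMartin Qμ →L[ℝ] CameronMartin Qν) :
    CameronMartin Qμ →L[ℝ] CameronMartin Qμ :=
  posSqrt (ContinuousLinearMap.id ℝ (CameronMartin Qμ) - ContinuousLinearMap.adjoint T ∘L T)

/-- `∫ f (F x + G y) μ(dy)`: the integral that defines the second quantization operator, with `F`
and `G` standing for the versions of `(T⋆)_∞` and of `((I - T⋆ T) ^ (1/2))_∞`. -/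
def quantizationIntegral (μ : Measure X) (F G : X →ₗ[ℝ] X) (f : X → ℝ) (x : X) : ℝ :=
  ∫ y, f (F x + G y) ∂μ

/-- The second quantization operator `Γ_{ν,μ}(T)` of a contraction `T : H_μ → H_ν`:
`(Γ_{ν,μ}(T) f)(x) = ∫ f ((T⋆)_∞ x + ((I - T⋆ T) ^ (1/2))_∞ y) μ(dy)`. -/
def secondQuantization {Qμ Qν : X →L[ℝ] X} (T : CameronMartin Qμ →L[ℝ] CameronMartin Qν)
    (f : X → ℝ) (x : X) : ℝ :=
  quantizationIntegral (gaussianMeasure 0 Qμ) (infExt (ContinuousLinearMap.adjoint T))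
    (infExt (defect T)) f x

variable (X) in
/-- Bounded Borel functions. -/
def boundedBorel : Set (X → ℝ) := {f | Measurable f ∧ ∃ M : ℝ, ∀ x, |f x| ≤ M}

variable (X) in
/-- Borel functions of at most exponential growth. -/
def expGrowth : Set (X → ℝ) :=
  {f | Measurable f ∧ ∃ M c : ℝ, 0 < M ∧ 0 < c ∧ ∀ x, |f x| ≤ M * Real.exp (c * ‖x‖)}

/-- The bounded operator `S : L^p(X, μ) → L^p(X, ν)` extends the operator `A`, which is defined on the
set `D` of functions on `X`. -/
def IsLpExtension (D : Set (X → ℝ)) (A : (X → ℝ) → X → ℝ) (p : ℝ≥0∞) [Fact (1 ≤ p)]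
    (μ ν : Measure X) (S : Lp ℝ p μ →L[ℝ] Lp ℝ p ν) : Prop :=
  ∀ f ∈ D, ∀ hf : MemLp f p μ, S (hf.toLp f) =ᵐ[ν] A f

/-- `ν` is an evolution system of (Borel probability) measures for the operators `P s t`, `s ≤ t`. -/
def IsEvolutionSystem (P : ℝ → ℝ → (X → ℝ) → X → ℝ) (ν : ℝ → Measure X) : Prop :=
  (∀ t, IsProbabilityMeasure (ν t)) ∧
  ∀ s t, s ≤ t → ∀ φ : BoundedContinuousFunction X ℝ, ∫ x, P s t φ x ∂(ν s) = ∫ x, φ x ∂(ν t)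

/-! ### The Ornstein–Uhlenbeck evolution operator

`U t s` is the evolution operator `U(t, s)`; only its values for `s ≤ t` matter. -/

/-- The integrand `U(t, r) B(r) B(r)⋆ U(t, r)⋆`. -/
def covIntegrand (U : ℝ → ℝ → X →L[ℝ] X) (B : ℝ → X →L[ℝ] X) (t r : ℝ) : X →L[ℝ] X :=
  U t r ∘L B r ∘L ContinuousLinearMap.adjoint (B r) ∘L ContinuousLinearMap.adjoint (U t r)

/-- `Q(t, s) = ∫_s^t U(t, r) B(r) B(r)⋆ U(t, r)⋆ dr`, for `s < t`. -/
def covOp (U : ℝ → ℝ → X →L[ℝ] X) (B : ℝ → X →L[ℝ] X) (t s : ℝ) : X →L[ℝ] X :=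
  strongIntegral (volume.restrict (Ioc s t)) (covIntegrand U B t)

/-- `Q(t, -∞) = ∫_{-∞}^t U(t, r) B(r) B(r)⋆ U(t, r)⋆ dr`. -/
def covOpInf (U : ℝ → ℝ → X →L[ℝ] X) (B : ℝ → X →L[ℝ] X) (t : ℝ) : X →L[ℝ] X :=
  strongIntegral (volume.restrict (Iic t)) (covIntegrand U B t)

/-- The Ornstein–Uhlenbeck evolution operator: `P_{t,t} = I` and
`(P_{s,t} φ)(x) = ∫ φ(y) N(U(t, s) x, Q(t, s))(dy)` for `s < t`. -/
def ouEvolution (U : ℝ → ℝ → X →L[ℝ] X) (B : ℝ → X →L[ℝ] X) (s t : ℝ) (φ : X → ℝ) (x : X) : ℝ :=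
  if s < t then ∫ y, φ y ∂(gaussianMeasure (U t s x) (covOp U B t s)) else φ x

/-- The measures `γ_t = N(0, Q(t, -∞))`. -/
def gammaMeasure (U : ℝ → ℝ → X →L[ℝ] X) (B : ℝ → X →L[ℝ] X) (t : ℝ) : Measure X :=
  gaussianMeasure 0 (covOpInf U B t)

/-- The standing assumptions on `U` and `B`. -/
structure OUHypothesis (U : ℝ → ℝ → X →L[ℝ] X) (B : ℝ → X →L[ℝ] X) : Prop where
  continuous_evolution : ∀ x, ContinuousOn (fun q : ℝ × ℝ => U q.2 q.1 x) {q | q.1 ≤ q.2}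
  evolution_self : ∀ t, U t t = ContinuousLinearMap.id ℝ X
  evolution_comp : ∀ s r t, s ≤ r → r ≤ t → U t r ∘L U r s = U t s
  bounded : ∃ K : ℝ, 0 < K ∧ ∀ t, ‖B t‖ ≤ K
  measurable : ∀ x, AEStronglyMeasurable (fun t => B t x) volume
  finite_trace : ∀ s t, s < t → posTrace (covOp U B t s) < ∞
  sup_trace : ∀ t, (⨆ s ∈ Iio t, posTrace (covOp U B t s)) < ∞
  evolution_tendsto : ∀ t x, Tendsto (fun s => U t s x) atBot (𝓝 0)

end Gaussian

end OUEvolution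

end

/-! Everything rests on the splitting `Q(t, -∞) = U(t, s) Q(s, -∞) U(t, s)⋆ + Q(t, s)`
(`OUHypothesis.covOpInf_apply`), obtained by cutting the integral at `s` and using the evolution
law.

Write `i_t` for the inclusion of `H_t` in `X`; then `i_t i_t⋆ = Q(t, -∞)`, so `‖i_t⋆ x‖² = ⟪Q(t, -∞)
x, x⟫`. Dropping the nonnegative term `Q(t, s)` gives `‖i_s⋆ U(t, s)⋆ x‖ ≤ ‖i_t⋆ x‖`, and a
Douglas-type range argument (`exists_restriction`) turns this domination into a contraction `V : H_s
→ H_t` that restricts `U(t, s)`. Put `L = V⋆`. Since `L i_t⋆ = i_s⋆ U(t, s)⋆`, the splitting also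
says that `‖(I - L⋆ L) ^ (1/2) i_t⋆ x‖² = ⟪Q(t, s) x, x⟫` (`norm_defect_adjoint_sq`).

A linear version of `T_∞` is the `L²` sum of a Gaussian series with coefficients `T eᵢ`, hence has
covariance `i T T⋆ i⋆`, with `i` the inclusion of the target space
(`IsLinearVersion.isGaussianWith_map`). Every version `G` of the defect operator therefore has law
`N(0, Q(t, s))` under `γ_t`, and `Γ^{F,G} f (x) = ∫ f (F x + y) N(0, Q(t, s))(dy)`. The operator
`P_{s,t}` has the same form with `U(t, s) x` in place of `F x`, so the two agree wherever `F x =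
U(t, s) x`. As `U(t, s)` is a bounded extension of `L⋆ = V`, it is itself a linear version and all
versions equal it almost everywhere (`IsLinearVersion.ae_eq`).

The splitting says moreover that `(x, y) ↦ U(t, s) x + y` carries `γ_s ⊗ N(0, Q(t, s))` to `γ_t`.
This gives the evolution system property and, with Jensen and Fubini, the contraction `L^p(γ_t) →
L^p(γ_s)` that extends both operators; density of simple functions gives uniqueness. -/

set_option linter.unusedSectionVars false

noncomputable section

namespace OUEvolution

universe u

/-! ### Square roots of nonnegative operators by a power-series type iteration. -/

section SquareRoot

variable {E : Type u} [NormedAddCommGroup E] [InnerProductSpace ℝ E] [CompleteSpace E]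

/-- The iteration `X ↦ (B + X ^ 2) / 2`, whose limit `X` satisfies `(1 - X) ^ 2 = 1 - B`. -/
def sqrtIter {A : Type*} [Ring A] [Module ℝ A] (b : A) : ℕ → A
  | 0 => 0
  | n + 1 => (1 / 2 : ℝ) • (b + sqrtIter b n * sqrtIter b n)

theorem sqrtIter_one_mem (n : ℕ) : sqrtIter (1 : ℝ) n ∈ Icc (0 : ℝ) 1 := by
  induction n with
  | zero => simp [sqrtIter]
  | succ n ih =>
    obtain ⟨h0, h1⟩ := ih
    simp only [sqrtIter, smul_eq_mul, mem_Icc]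
    constructor <;> nlinarith

theorem sqrtIter_one_monotone : Monotone (sqrtIter (1 : ℝ)) := by
  refine monotone_nat_of_le_succ fun n => ?_
  simp only [sqrtIter, smul_eq_mul]
  nlinarith [sq_nonneg (1 - sqrtIter (1 : ℝ) n)]

theorem norm_sqrtIter_le {A : Type*} [NormedRing A] [NormedAlgebra ℝ A] {b : A} (hb : ‖b‖ ≤ 1)
    (n : ℕ) : ‖sqrtIter b n‖ ≤ sqrtIter (1 : ℝ) n := by
  induction n with
  | zero => simp [sqrtIter]
  | succ n ih =>
    simp only [sqrtIter, smul_eq_mul]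
    rw [norm_smul, Real.norm_of_nonneg (by norm_num)]
    gcongr
    exact (norm_add_le _ _).trans (add_le_add hb ((norm_mul_le _ _).trans
      (mul_le_mul ih ih (norm_nonneg _) (sqrtIter_one_mem n).1)))

/-- An increment is half of `x_{n+1} d + d x_n`, with `d` the preceding increment, so the scalar
iteration with `b = 1` majorizes it inductively. The factors are kept in order because the ring is
not commutative. -/
theorem norm_sqrtIter_succ_sub_le {A : Type*} [NormedRing A] [NormedAlgebra ℝ A] {b : A}
    (hb : ‖b‖ ≤ 1) (n : ℕ) :
    ‖sqrtIter b (n + 1) - sqrtIter b n‖ ≤ sqrtIter (1 : ℝ) (n + 1) - sqrtIter (1 : ℝ) n := by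
  induction n with
  | zero =>
    simp only [sqrtIter, mul_zero, add_zero, sub_zero]
    rw [norm_smul, smul_eq_mul, Real.norm_of_nonneg (by norm_num)]
    gcongr
  | succ n ih =>
    have key : sqrtIter b (n + 2) - sqrtIter b (n + 1) = (1 / 2 : ℝ) •
        (sqrtIter b (n + 1) * (sqrtIter b (n + 1) - sqrtIter b n) +
          (sqrtIter b (n + 1) - sqrtIter b n) * sqrtIter b n) := by
      rw [sqrtIter.eq_2 b (n + 1)]
      nth_rewrite 3 [sqrtIter.eq_2 b n]
      rw [← smul_sub]
      congr 1
      noncomm_ring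
    have key' : sqrtIter (1 : ℝ) (n + 2) - sqrtIter (1 : ℝ) (n + 1) = (1 / 2 : ℝ) *
        (sqrtIter (1 : ℝ) (n + 1) * (sqrtIter (1 : ℝ) (n + 1) - sqrtIter (1 : ℝ) n) +
          (sqrtIter (1 : ℝ) (n + 1) - sqrtIter (1 : ℝ) n) * sqrtIter (1 : ℝ) n) := by
      rw [sqrtIter.eq_2 (1 : ℝ) (n + 1)]
      nth_rewrite 3 [sqrtIter.eq_2 (1 : ℝ) n]
      simp only [smul_eq_mul]
      ring
    have h0 := sub_nonneg.2 (sqrtIter_one_monotone n.le_succ)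
    have h1 := (sqrtIter_one_mem (n + 1)).1
    rw [key, key', norm_smul, Real.norm_of_nonneg (by norm_num)]
    refine mul_le_mul_of_nonneg_left ?_ (by norm_num)
    refine (norm_add_le _ _).trans (add_le_add ((norm_mul_le _ _).trans ?_)
      ((norm_mul_le _ _).trans ?_))
    · exact mul_le_mul (norm_sqrtIter_le hb _) ih (norm_nonneg _) h1
    · exact mul_le_mul ih (norm_sqrtIter_le hb _) (norm_nonneg _) h0

/-- The majorizing scalar increments telescope and the scalar sequence stays below `1`, so the
increments are summable in norm. -/
theorem exists_tendsto_sqrtIter {A : Type*} [NormedRing A] [NormedAlgebra ℝ A] [CompleteSpace A]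
    {b : A} (hb : ‖b‖ ≤ 1) : ∃ x, Tendsto (sqrtIter b) atTop (𝓝 x) := by
  refine cauchySeq_tendsto_of_complete (cauchySeq_of_summable_dist ?_)
  refine Summable.of_nonneg_of_le (f := fun n => sqrtIter (1 : ℝ) (n + 1) - sqrtIter (1 : ℝ) n)
    (fun _ => dist_nonneg)
    (fun n => by rw [dist_comm, dist_eq_norm]; exact norm_sqrtIter_succ_sub_le hb n) ?_
  refine summable_of_sum_range_le (c := 1)
    (fun n => sub_nonneg.2 (sqrtIter_one_monotone n.le_succ)) fun n => ?_
  rw [Finset.sum_range_sub]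
  simpa [sqrtIter] using (sqrtIter_one_mem n).2

/-- The limit satisfies `2 X = B + X²`, that is `(1 - X)² = 1 - B`; it is symmetric with `‖X‖ ≤ 1`,
which makes `1 - X` nonnegative. -/
theorem exists_isPositive_sqrt_one_sub {B : E →L[ℝ] E} (hB : B.IsSymmetric) (hb : ‖B‖ ≤ 1) :
    ∃ R : E →L[ℝ] E, R.IsPositive ∧ R ∘L R = 1 - B := by
  obtain ⟨X, hX⟩ := exists_tendsto_sqrtIter hb
  have hnorm : ‖X‖ ≤ 1 := le_of_tendsto hX.norm
    (.of_forall fun n => (norm_sqrtIter_le hb n).trans (sqrtIter_one_mem n).2)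
  have hsymm : ∀ n x y, ⟪sqrtIter B n x, y⟫ = ⟪x, sqrtIter B n y⟫ := by
    intro n
    induction n with
    | zero => simp [sqrtIter]
    | succ n ih =>
      intro x y
      have hmul : ∀ z, (sqrtIter B n * sqrtIter B n) z = sqrtIter B n (sqrtIter B n z) :=
        fun _ => rfl
      simp only [sqrtIter, smul_apply, add_apply, hmul, inner_smul_left, inner_smul_right,
        inner_add_left, inner_add_right, ih, conj_trivial]
      rw [show ⟪B x, y⟫ = ⟪x, B y⟫ from hB x y]
  have happ : ∀ x, Tendsto (fun n => sqrtIter B n x) atTop (𝓝 (X x)) := fun x =>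
    ((ContinuousLinearMap.apply ℝ E x).continuous.tendsto X).comp hX
  have hXsymm : ∀ x y, ⟪X x, y⟫ = ⟪x, X y⟫ := fun x y =>
    tendsto_nhds_unique (((happ x).inner tendsto_const_nhds).congr fun n => hsymm n x y)
      (tendsto_const_nhds.inner (happ y))
  have hfix : X = (1 / 2 : ℝ) • (B + X * X) := by
    refine tendsto_nhds_unique ((tendsto_add_atTop_iff_nat 1).2 hX) ?_
    simp only [sqrtIter]
    exact (tendsto_const_nhds.add (hX.mul hX)).const_smul _
  refine ⟨1 - X, ?_, ?_⟩
  · refine ⟨fun x y => ?_, fun x => ?_⟩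
    · have := hXsymm x y
      simp only [ContinuousLinearMap.coe_coe, sub_apply, inner_sub_left,
        inner_sub_right, this, one_apply_eq_self]
    · have h1 : ⟪X x, x⟫ ≤ ‖x‖ * ‖x‖ := (real_inner_le_norm _ _).trans
        (mul_le_mul_of_nonneg_right ((X.le_of_opNorm_le hnorm x).trans (by simp)) (norm_nonneg x))
      have h2 := real_inner_self_eq_norm_mul_norm x
      simp [ContinuousLinearMap.reApplyInnerSelf_apply, inner_sub_left]
      linarith
  · have h2 : (2 : ℝ) • X = B + X * X := by
      conv_lhs => rw [hfix]
      rw [smul_smul]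
      norm_num
    rw [two_smul] at h2
    change (1 - X) * (1 - X) = 1 - B
    have : (1 - X) * (1 - X) = 1 - (X + X) + X * X := by noncomm_ring
    rw [this, h2]
    noncomm_ring

/-- Cauchy–Schwarz for a semidefinite form: the quadratic `c ↦ ⟪A (x + c y), x + c y⟫` is
nonnegative, so its discriminant is not positive. -/
theorem _root_.ContinuousLinearMap.IsPositive.inner_sq_le {A : E →L[ℝ] E} (hA : A.IsPositive)
    (x y : E) : ⟪A x, y⟫ ^ 2 ≤ ⟪A x, x⟫ * ⟪A y, y⟫ := by
  have h : ∀ c : ℝ, 0 ≤ ⟪A y, y⟫ * (c * c) + (2 * ⟪A x, y⟫) * c + ⟪A x, x⟫ := by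
    intro c
    have h1 := hA.inner_nonneg_left (x + c • y)
    have h2 : ⟪A y, x⟫ = ⟪A x, y⟫ := by
      rw [hA.inner_left_eq_inner_right, real_inner_comm]
    simp only [map_add, map_smul, inner_add_left, inner_add_right, inner_smul_left,
      inner_smul_right, h2, conj_trivial] at h1
    nlinarith
  have := discrim_le_zero h
  unfold discrim at this
  nlinarith

theorem _root_.ContinuousLinearMap.IsPositive.norm_apply_sq_le {A : E →L[ℝ] E}
    (hA : A.IsPositive) (x : E) : ‖A x‖ ^ 2 ≤ ‖A‖ * ⟪A x, x⟫ := by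
  have h1 := hA.inner_sq_le x (A x)
  rw [real_inner_self_eq_norm_sq] at h1
  have h2 : ⟪A (A x), A x⟫ ≤ ‖A‖ * ‖A x‖ ^ 2 := by
    refine (real_inner_le_norm _ _).trans ?_
    rw [sq, ← mul_assoc]
    exact mul_le_mul_of_nonneg_right (A.le_opNorm _) (norm_nonneg _)
  have h3 := hA.inner_nonneg_left x
  rcases (sq_nonneg ‖A x‖).eq_or_lt with h | h
  · rw [← h]
    positivity
  · nlinarith [mul_le_mul_of_nonneg_left h2 h3]

theorem exists_isPositive_sqrt {A : E →L[ℝ] E} (hA : A.IsPositive) :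
    ∃ R : E →L[ℝ] E, R.IsPositive ∧ R ∘L R = A := by
  -- Rescaling makes `1 - c⁻¹ A` a symmetric contraction; the added `1` keeps `c` invertible when `A
  -- = 0`.
  set c : ℝ := ‖A‖ + 1 with hc
  have hc0 : 0 < c := by positivity
  have hsymm : (1 - c⁻¹ • A).IsSymmetric := by
    intro x y
    have := hA.inner_left_eq_inner_right x y
    simp [inner_sub_left, inner_sub_right, inner_smul_left, inner_smul_right, this]
  have hnorm : ‖1 - c⁻¹ • A‖ ≤ 1 := by
    refine ContinuousLinearMap.opNorm_le_bound _ zero_le_one fun x => ?_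
    rw [one_mul]
    refine abs_le_of_sq_le_sq' ?_ (norm_nonneg _) |>.2
    have h1 := hA.norm_apply_sq_le x
    have h2 := hA.inner_nonneg_left x
    have h3 : ‖(1 - c⁻¹ • A) x‖ ^ 2 = ‖x‖ ^ 2 - 2 * (c⁻¹ * ⟪A x, x⟫) + c⁻¹ ^ 2 * ‖A x‖ ^ 2 := by
      simp only [sub_apply, one_apply_eq_self,
        smul_apply]
      rw [norm_sub_sq_real, inner_smul_right, norm_smul, mul_pow, Real.norm_eq_abs, sq_abs,
        real_inner_comm]
    have h4 : c⁻¹ ^ 2 * ‖A x‖ ^ 2 ≤ c⁻¹ * ⟪A x, x⟫ := by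
      rw [sq c⁻¹, mul_assoc]
      refine mul_le_mul_of_nonneg_left ?_ (by positivity)
      rw [inv_mul_le_iff₀ hc0]
      refine h1.trans (mul_le_mul_of_nonneg_right (by linarith) h2)
    have h5 : 0 ≤ c⁻¹ * ⟪A x, x⟫ := by positivity
    linarith
  obtain ⟨R, hR, hR2⟩ := exists_isPositive_sqrt_one_sub hsymm hnorm
  refine ⟨√c • R, hR.smul_of_nonneg (Real.sqrt_nonneg c), ?_⟩
  rw [ContinuousLinearMap.smul_comp, ContinuousLinearMap.comp_smul, smul_smul,
    Real.mul_self_sqrt hc0.le, hR2, sub_sub_cancel, smul_smul, mul_inv_cancel₀ hc0.ne', one_smul]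

theorem posSqrt_isPositive {A : E →L[ℝ] E} (hA : A.IsPositive) : (posSqrt A).IsPositive := by
  rw [posSqrt, dif_pos (exists_isPositive_sqrt hA)]
  exact (exists_isPositive_sqrt hA).choose_spec.1

theorem posSqrt_comp_posSqrt {A : E →L[ℝ] E} (hA : A.IsPositive) :
    posSqrt A ∘L posSqrt A = A := by
  rw [posSqrt, dif_pos (exists_isPositive_sqrt hA)]
  exact (exists_isPositive_sqrt hA).choose_spec.2

theorem posSqrt_posSqrt_apply {A : E →L[ℝ] E} (hA : A.IsPositive) (x : E) :
    posSqrt A (posSqrt A x) = A x :=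
  DFunLike.congr_fun (posSqrt_comp_posSqrt hA) x

end SquareRoot

/-! ### Range criterion, Hilbert–Schmidt operators, spectral theorem. -/

section HilbertSchmidt

variable {E : Type*} [NormedAddCommGroup E] [InnerProductSpace ℝ E] [CompleteSpace E]
  {H : Type*} [NormedAddCommGroup H] [InnerProductSpace ℝ H] [CompleteSpace H]

/-- A vector of `E` lies in the range of `A` as soon as the functional that it defines is dominated
by `x ↦ ‖A⋆ x‖`. -/
theorem exists_apply_eq_of_abs_inner_le (A : H →L[ℝ] E) {y : E} {C : ℝ} (hC : 0 ≤ C)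
    (h : ∀ x, |⟪y, x⟫| ≤ C * ‖A.adjoint x‖) : ∃ z : H, A z = y ∧ ‖z‖ ≤ C := by
  set T : E →ₗ[ℝ] H := (A.adjoint : E →ₗ[ℝ] H) with hT
  have hker : LinearMap.ker T ≤ LinearMap.ker (innerSL ℝ y : E →ₗ[ℝ] ℝ) := by
    intro x hx
    have hx' : A.adjoint x = 0 := hx
    have := h x
    rw [hx', norm_zero, mul_zero] at this
    exact abs_nonpos_iff.1 this
  -- The functional `A⋆ x ↦ ⟪y, x⟫` is well defined on the range of `A⋆` and bounded by `C`;
  -- Hahn–Banach extends it with the same norm, and its Riesz vector is the preimage sought.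
  let f : LinearMap.range T →ₗ[ℝ] ℝ :=
    (Submodule.liftQ (LinearMap.ker T) (innerSL ℝ y : E →ₗ[ℝ] ℝ) hker) ∘ₗ
      (T.quotKerEquivRange.symm : LinearMap.range T →ₗ[ℝ] _)
  have hf : ∀ x, f ⟨T x, LinearMap.mem_range_self T x⟩ = ⟪y, x⟫ := by
    intro x
    simp only [f, LinearMap.comp_apply, LinearEquiv.coe_coe]
    rw [LinearMap.quotKerEquivRange_symm_apply_image]
    rfl
  have hfb : ∀ z, ‖f z‖ ≤ C * ‖z‖ := by
    rintro ⟨_, x, rfl⟩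
    rw [hf]
    exact h x
  obtain ⟨g, hg, hgn⟩ := exists_extension_norm_eq (LinearMap.range T) (f.mkContinuous C hfb)
  refine ⟨(InnerProductSpace.toDual ℝ H).symm g, ?_, ?_⟩
  · refine ext_inner_right ℝ fun x => ?_
    rw [← ContinuousLinearMap.adjoint_inner_right, InnerProductSpace.toDual_symm_apply]
    rw [show A.adjoint x = ((⟨T x, LinearMap.mem_range_self T x⟩ : LinearMap.range T) : H) from rfl,
      hg]
    exact hf x
  · rw [LinearIsometryEquiv.norm_map, hgn]
    exact f.mkContinuous_norm_le hC hfb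

theorem tsum_enorm_inner_sq {ι : Type*} (b : HilbertBasis ι ℝ E) (x : E) :
    ∑' i, ‖⟪b i, x⟫‖ₑ ^ 2 = ‖x‖ₑ ^ 2 := by
  have h := b.hasSum_inner_mul_inner x x
  have h2 : ∀ i, ‖⟪b i, x⟫‖ₑ ^ 2 = ENNReal.ofReal (⟪x, b i⟫ * ⟪b i, x⟫) := fun i => by
    rw [real_inner_comm, ← enorm_pow, ← sq, Real.enorm_of_nonneg (sq_nonneg _)]
  simp_rw [h2]
  rw [← ENNReal.ofReal_tsum_of_nonneg _ h.summable, h.tsum_eq, real_inner_self_eq_norm_sq,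
    ← Real.enorm_of_nonneg (sq_nonneg _), enorm_pow, enorm_norm]
  intro i
  rw [real_inner_comm]
  exact mul_self_nonneg _

/-- By Parseval both sides are the double sum of the squared matrix entries of `A`. -/
theorem tsum_enorm_apply_sq_eq_adjoint {ι κ : Type*} (b : HilbertBasis ι ℝ E)
    (e : HilbertBasis κ ℝ H) (A : E →L[ℝ] H) :
    ∑' i, ‖A (b i)‖ₑ ^ 2 = ∑' k, ‖A.adjoint (e k)‖ₑ ^ 2 := by
  simp_rw [← tsum_enorm_inner_sq e, ← tsum_enorm_inner_sq b]
  rw [ENNReal.tsum_comm]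
  refine tsum_congr fun k => tsum_congr fun i => ?_
  rw [ContinuousLinearMap.adjoint_inner_right, real_inner_comm]

/-- The Hilbert–Schmidt norm dominates the operator norm. Parseval in `b` gives this for `A⋆`, and
`‖A x‖² ≤ ‖x‖ ‖A⋆ A x‖` transfers it to `A`. -/
theorem enorm_apply_sq_le {ι : Type*} (b : HilbertBasis ι ℝ E) (A : E →L[ℝ] H) (x : E) :
    ‖A x‖ₑ ^ 2 ≤ (∑' i, ‖A (b i)‖ₑ ^ 2) * ‖x‖ₑ ^ 2 := by
  have hadj : ∀ y, ‖A.adjoint y‖ₑ ^ 2 ≤ (∑' i, ‖A (b i)‖ₑ ^ 2) * ‖y‖ₑ ^ 2 := by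
    intro y
    rw [← tsum_enorm_inner_sq b, ← ENNReal.tsum_mul_right]
    refine ENNReal.tsum_le_tsum fun i => ?_
    rw [ContinuousLinearMap.adjoint_inner_right, ← mul_pow]
    gcongr
    rw [← enorm_norm (A (b i)), ← enorm_norm y, ← enorm_mul]
    exact enorm_le_iff_norm_le.2 (by simpa using abs_real_inner_le_norm _ _)
  rcases eq_or_ne (‖A x‖ₑ) 0 with h0 | h0
  · simp [h0]
  have h1 : ‖A x‖ₑ ^ 2 * ‖A x‖ₑ ^ 2 ≤ ((∑' i, ‖A (b i)‖ₑ ^ 2) * ‖x‖ₑ ^ 2) * ‖A x‖ₑ ^ 2 := by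
    have h2 : ‖A x‖ₑ ^ 2 ≤ ‖x‖ₑ * ‖A.adjoint (A x)‖ₑ := by
      rw [← enorm_norm (A x), ← enorm_pow, ← real_inner_self_eq_norm_sq,
        ← ContinuousLinearMap.adjoint_inner_right, ← enorm_norm x, ← enorm_norm (A.adjoint (A x)),
        ← enorm_mul]
      exact enorm_le_iff_norm_le.2 (by simpa using abs_real_inner_le_norm _ _)
    calc ‖A x‖ₑ ^ 2 * ‖A x‖ₑ ^ 2 ≤ (‖x‖ₑ * ‖A.adjoint (A x)‖ₑ) * (‖x‖ₑ * ‖A.adjoint (A x)‖ₑ) := by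
          gcongr
      _ = ‖x‖ₑ ^ 2 * ‖A.adjoint (A x)‖ₑ ^ 2 := by ring
      _ ≤ ‖x‖ₑ ^ 2 * ((∑' i, ‖A (b i)‖ₑ ^ 2) * ‖A x‖ₑ ^ 2) := by gcongr; exact hadj _
      _ = _ := by ring
  exact (ENNReal.mul_le_mul_iff_left (pow_ne_zero 2 h0) (by simp)).1 h1

/-- A Hilbert–Schmidt operator is compact. -/
theorem isCompactOperator_of_tsum_ne_top {ι : Type*} (b : HilbertBasis ι ℝ E) (A : E →L[ℝ] H)
    (h : ∑' i, ‖A (b i)‖ₑ ^ 2 ≠ ∞) : IsCompactOperator A := by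
  classical
  -- Finite-rank truncations of `A`; their distance to `A` is controlled by the tail of the
  -- Hilbert–Schmidt sum.
  let F : Finset ι → E →L[ℝ] H := fun J => ∑ i ∈ J, (innerSL ℝ (b i)).smulRight (A (b i))
  have hFb : ∀ J i, (A - F J) (b i) = if i ∈ J then 0 else A (b i) := by
    intro J i
    have : F J (b i) = if i ∈ J then A (b i) else 0 := by
      simp only [F, sum_apply, ContinuousLinearMap.smulRight_apply,
        innerSL_apply_apply, orthonormal_iff_ite.1 b.orthonormal, ite_smul, one_smul, zero_smul,
        Finset.sum_ite_eq']
    rw [sub_apply, this]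
    split_ifs <;> simp
  have hF : ∀ J, IsCompactOperator (F J) := by
    intro J
    induction J using Finset.induction_on with
    | empty => simpa [F] using isCompactOperator_zero
    | insert i J hi ih =>
      have : F (insert i J) = (innerSL ℝ (b i)).smulRight (A (b i)) + F J := by
        simp only [F]
        rw [Finset.sum_insert hi]
      rw [this]
      refine IsCompactOperator.add ?_ ih
      exact (isCompactOperator_of_locallyCompactSpace_rng
        (ContinuousLinearMap.toSpanSingleton ℝ (A (b i)))).comp_clm (innerSL ℝ (b i))
  refine isCompactOperator_of_tendsto (l := atTop) (F := F) ?_ (.of_forall hF)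
  have hle : ∀ J, ‖F J - A‖ₑ ^ 2 ≤ ∑' i : { i // i ∉ J }, ‖A (b i)‖ₑ ^ 2 := by
    intro J
    have hsum : ∑' i, ‖(A - F J) (b i)‖ₑ ^ 2 = ∑' i : { i // i ∉ J }, ‖A (b i)‖ₑ ^ 2 := by
      refine Eq.trans ?_ (tsum_subtype {i | i ∉ J} fun i => ‖A (b i)‖ₑ ^ 2).symm
      refine tsum_congr fun i => ?_
      rw [hFb]
      by_cases hi : i ∈ J <;> simp [hi]
    have hfin : ∑' i : { i // i ∉ J }, ‖A (b i)‖ₑ ^ 2 ≠ ∞ :=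
      ((ENNReal.tsum_comp_le_tsum_of_injective Subtype.val_injective _).trans_lt h.lt_top).ne
    set c := ∑' i : { i // i ∉ J }, ‖A (b i)‖ₑ ^ 2 with hc
    have h2 : ‖F J - A‖ ≤ √c.toReal := by
      refine ContinuousLinearMap.opNorm_le_bound _ (Real.sqrt_nonneg _) fun x => ?_
      have h3 := enorm_apply_sq_le b (A - F J) x
      rw [hsum] at h3
      rw [← neg_sub, neg_apply, norm_neg]
      have h4 := ENNReal.toReal_mono (ENNReal.mul_ne_top hfin (by simp)) h3
      simp only [ENNReal.toReal_mul, ENNReal.toReal_pow, toReal_enorm] at h4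
      refine le_of_sq_le_sq ?_ (by positivity)
      rw [mul_pow, Real.sq_sqrt ENNReal.toReal_nonneg]
      exact h4
    have h5 : ‖F J - A‖ ^ 2 ≤ c.toReal := by
      rw [← Real.sq_sqrt (ENNReal.toReal_nonneg (a := c))]
      gcongr
    rw [← ENNReal.ofReal_toReal hfin, ← enorm_norm, ← enorm_pow,
      Real.enorm_of_nonneg (sq_nonneg _)]
    exact ENNReal.ofReal_le_ofReal h5
  have h0 : Tendsto (fun J => ‖F J - A‖ₑ ^ 2) atTop (𝓝 0) :=
    tendsto_of_tendsto_of_tendsto_of_le_of_le tendsto_const_nhds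
      (ENNReal.tendsto_tsum_compl_atTop_zero h) (fun _ => zero_le) hle
  rw [tendsto_iff_norm_sub_tendsto_zero]
  have h1 := (ENNReal.tendsto_toReal ENNReal.zero_ne_top).comp h0
  have h2 := h1.sqrt
  simpa [Function.comp_def, Real.sqrt_sq] using h2

/-- The spectral theorem for compact self-adjoint operators: there is an orthonormal basis of
eigenvectors. -/
theorem exists_hilbertBasis_eigenvectors (T : H →L[ℝ] H) (hT : IsCompactOperator T)
    (hT' : T.IsSymmetric) :
    ∃ (w : Set H) (e : HilbertBasis w ℝ H) (lam : w → ℝ), ∀ i, T (e i) = lam i • e i := by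
  let V : ℝ → Submodule ℝ H := fun μ => Module.End.eigenspace (T : Module.End ℝ H) μ
  have hcomp : ∀ μ, CompleteSpace (V μ) := fun μ =>
    (ContinuousLinearMap.isClosed_eigenspace T μ).completeSpace_coe
  choose s b hb using fun μ => exists_hilbertBasis ℝ (V μ)
  -- Bases of all eigenspaces put together; for `μ` that is not an eigenvalue the basis is empty.
  -- Compactness and symmetry leave no vector orthogonal to all of them.
  let v : (Σ μ, s μ) → H := fun a => (b a.1 a.2 : H)
  have hv : Orthonormal ℝ v :=
    hT'.orthogonalFamily_eigenspaces.orthonormal_sigma_orthonormal fun μ => (b μ).orthonormal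
  have hspan : (Submodule.span ℝ (range (Subtype.val : range v → H)))ᗮ = ⊥ := by
    rw [Subtype.range_coe, eq_bot_iff,
      ← ContinuousLinearMap.orthogonalComplement_iSup_eigenspaces_eq_bot hT hT',
      ← Submodule.iInf_orthogonal]
    intro x hx
    refine Submodule.mem_iInf _ |>.2 fun μ => (Submodule.mem_orthogonal' _ _).2 fun y hy => ?_
    have hx' : ∀ a, ⟪v a, x⟫ = 0 := fun a =>
      (Submodule.mem_orthogonal _ _).1 hx _ (Submodule.subset_span ⟨a, rfl⟩)
    have h1 := ((b μ).hasSum_repr ⟨y, hy⟩).mapL ((innerSL ℝ x) ∘L (V μ).subtypeL)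
    refine (h1.unique ?_)
    have h2 : (fun i => (innerSL ℝ x ∘L (V μ).subtypeL) ((b μ).repr ⟨y, hy⟩ i • b μ i))
        = fun _ => 0 := by
      funext i
      rw [map_smul]
      have : ⟪x, (b μ i : H)⟫ = 0 := by
        rw [real_inner_comm]
        exact hx' ⟨μ, i⟩
      simp [this]
    rw [h2]
    exact hasSum_zero
  refine ⟨range v, HilbertBasis.mkOfOrthogonalEqBot hv.toSubtypeRange hspan,
    fun i => i.2.choose.1, fun i => ?_⟩
  rw [HilbertBasis.coe_mkOfOrthogonalEqBot]
  have h1 : v i.2.choose = i := i.2.choose_spec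
  have h2 : T (v i.2.choose) = i.2.choose.1 • v i.2.choose :=
    Module.End.mem_eigenspace_iff.1 (b i.2.choose.1 i.2.choose.2).2
  rw [h1] at h2
  exact h2

end HilbertSchmidt

/-! ### Cameron–Martin spaces: factorization of the covariance and eigenbases. -/

section CameronMartinSpace

variable {E : Type u} [NormedAddCommGroup E] [InnerProductSpace ℝ E] [CompleteSpace E]

theorem RangeSpace.incl_injective (R : E →L[ℝ] E) : Function.Injective (RangeSpace.incl R) :=
  Subtype.val_injective

theorem RangeSpace.exists_incl_eq (R : E →L[ℝ] E) (x : E) :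
    ∃ h : RangeSpace R, RangeSpace.incl R h = R x :=
  ⟨(⟨R x, x, rfl⟩ : LinearMap.range (R : E →ₗ[ℝ] E)), rfl⟩

theorem RangeSpace.pinv_eq {R : E →L[ℝ] E} {y : RangeSpace R} {v : E}
    (hv : v ∈ (LinearMap.ker (R : E →ₗ[ℝ] E))ᗮ) (h : R v = RangeSpace.incl R y) :
    RangeSpace.pinv R y = v := by
  have h1 : RangeSpace.pinv R y - v ∈ LinearMap.ker (R : E →ₗ[ℝ] E) := by
    change R (RangeSpace.pinv R y - v) = 0
    rw [map_sub, RangeSpace.apply_pinv, h, sub_self]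
  have h2 : RangeSpace.pinv R y - v ∈ (LinearMap.ker (R : E →ₗ[ℝ] E))ᗮ :=
    Submodule.sub_mem _ (RangeSpace.pinv_mem R y) hv
  exact sub_eq_zero.1 (inner_self_eq_zero (𝕜 := ℝ).1 ((Submodule.mem_orthogonal _ _).1 h2 _ h1))

theorem _root_.ContinuousLinearMap.IsPositive.apply_mem_ker_orthogonal {R : E →L[ℝ] E}
    (hR : R.IsPositive) (x : E) : R x ∈ (LinearMap.ker (R : E →ₗ[ℝ] E))ᗮ := by
  refine (Submodule.mem_orthogonal' _ _).2 fun y hy => ?_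
  rw [hR.inner_left_eq_inner_right, show R y = 0 from hy, inner_zero_right]

/-- The inclusion of the Cameron–Martin space, as a bounded operator. -/
def cmInclL (Q : E →L[ℝ] E) : CameronMartin Q →L[ℝ] E :=
  (cmIncl Q).mkContinuous ‖posSqrt Q‖ fun h => by
    rw [cmIncl, ← RangeSpace.apply_pinv, RangeSpace.norm_def]
    exact (posSqrt Q).le_opNorm _

@[simp]
theorem cmInclL_apply (Q : E →L[ℝ] E) (h : CameronMartin Q) : cmInclL Q h = cmIncl Q h := rfl

theorem cmInclL_injective (Q : E →L[ℝ] E) : Function.Injective (cmInclL Q) :=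
  RangeSpace.incl_injective _

variable {Q : E →L[ℝ] E}

/-- The factorization `i i⋆ = Q`: the vector `i⋆ x` is the element of the Cameron–Martin space whose
pseudo-inverse image is `Q ^ (1/2) x`. Traces and covariances are computed below through `i⋆`. -/
theorem cmInclL_adjoint_apply (hQ : Q.IsPositive) (x : E) :
    cmInclL Q ((cmInclL Q).adjoint x) = Q x := by
  have hR := posSqrt_isPositive hQ
  obtain ⟨h0, hh0⟩ := RangeSpace.exists_incl_eq (posSqrt Q) (posSqrt Q x)
  have hp : cmPinv Q h0 = posSqrt Q x :=
    RangeSpace.pinv_eq (hR.apply_mem_ker_orthogonal x) hh0.symm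
  have : (cmInclL Q).adjoint x = h0 := by
    refine ext_inner_right ℝ fun h => ?_
    rw [ContinuousLinearMap.adjoint_inner_left, RangeSpace.inner_def, hp,
      hR.inner_left_eq_inner_right, RangeSpace.apply_pinv]
    rfl
  rw [this, cmInclL_apply, cmIncl, hh0, posSqrt_posSqrt_apply hQ]

theorem norm_cmInclL_adjoint_sq (hQ : Q.IsPositive) (x : E) :
    ‖(cmInclL Q).adjoint x‖ ^ 2 = ⟪Q x, x⟫ := by
  rw [← real_inner_self_eq_norm_sq, ContinuousLinearMap.adjoint_inner_left,
    cmInclL_adjoint_apply hQ, real_inner_comm]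

theorem enorm_cmInclL_adjoint_sq (hQ : Q.IsPositive) (x : E) :
    ‖(cmInclL Q).adjoint x‖ₑ ^ 2 = ENNReal.ofReal ⟪Q x, x⟫ := by
  rw [← norm_cmInclL_adjoint_sq hQ, ← Real.enorm_of_nonneg (sq_nonneg _), enorm_pow, enorm_norm]

theorem posTrace_eq_tsum (hQ : Q.IsPositive) :
    posTrace Q = ∑' i, ‖(cmInclL Q).adjoint (basis E i)‖ₑ ^ 2 := by
  simp_rw [enorm_cmInclL_adjoint_sq hQ]
  rfl

theorem tsum_enorm_cmInclL_sq (hQ : Q.IsPositive) {κ : Type*}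
    (e : HilbertBasis κ ℝ (CameronMartin Q)) : ∑' k, ‖cmInclL Q (e k)‖ₑ ^ 2 = posTrace Q := by
  rw [posTrace_eq_tsum hQ, tsum_enorm_apply_sq_eq_adjoint (basis E) e,
    ContinuousLinearMap.adjoint_adjoint]

/-- Finite trace makes `i⋆` Hilbert–Schmidt, so `i⋆ i` is compact and self-adjoint on the
Cameron–Martin space; applying `i` to `i⋆ i e = λ e` gives an eigenvector of `Q = i i⋆`. -/
theorem exists_eigenbasis (hQ : Q.IsPositive) (htr : posTrace Q ≠ ∞) :
    ∃ (w : Set (CameronMartin Q)) (e : HilbertBasis w ℝ (CameronMartin Q)) (lam : w → ℝ),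
      ∀ i, Q (cmIncl Q (e i)) = lam i • cmIncl Q (e i) := by
  have hc : IsCompactOperator ((cmInclL Q).adjoint) :=
    isCompactOperator_of_tsum_ne_top (basis E) _ (by rwa [← posTrace_eq_tsum hQ])
  have hsymm : ((cmInclL Q).adjoint ∘L cmInclL Q).IsSymmetric := fun x y => by
    simp only [ContinuousLinearMap.coe_coe, ContinuousLinearMap.comp_apply,
      ContinuousLinearMap.adjoint_inner_left, ContinuousLinearMap.adjoint_inner_right]
  obtain ⟨w, e, lam, h⟩ := exists_hilbertBasis_eigenvectors
    ((cmInclL Q).adjoint ∘L cmInclL Q) (hc.comp_clm (cmInclL Q)) hsymm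
  refine ⟨w, e, lam, fun i => ?_⟩
  rw [← cmInclL_apply, ← cmInclL_adjoint_apply hQ, ← map_smul]
  exact congrArg _ (h i)

section Eigenvector

variable {e : CameronMartin Q} {l : ℝ}

theorem eigenvalue_mul_norm_sq (hQ : Q.IsPositive) (h : Q (cmIncl Q e) = l • cmIncl Q e) :
    l * ‖e‖ ^ 2 = ‖cmIncl Q e‖ ^ 2 := by
  have h1 : (cmInclL Q).adjoint (cmInclL Q e) = l • e := by
    refine cmInclL_injective Q ?_
    rw [cmInclL_adjoint_apply hQ, map_smul]
    exact h
  rw [← cmInclL_apply, ← real_inner_self_eq_norm_sq (cmInclL Q e),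
    ← ContinuousLinearMap.adjoint_inner_left, h1, inner_smul_left, real_inner_self_eq_norm_sq]
  rfl

theorem eigenvalue_pos (hQ : Q.IsPositive) (h : Q (cmIncl Q e) = l • cmIncl Q e)
    (he : ‖e‖ = 1) : 0 < l := by
  have h1 := eigenvalue_mul_norm_sq hQ h
  rw [he, one_pow, mul_one] at h1
  rw [h1]
  have : cmIncl Q e ≠ 0 := fun h0 => by
    have : e = 0 := RangeSpace.incl_injective _ (by rw [h0, map_zero])
    simp [this] at he
  positivity

theorem apply_cmPinv_eigenvector (hQ : Q.IsPositive) (h : Q (cmIncl Q e) = l • cmIncl Q e) :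
    Q (cmPinv Q e) = l • cmPinv Q e := by
  have hR := posSqrt_isPositive hQ
  refine (RangeSpace.pinv_eq (y := l • e) (v := Q (cmPinv Q e)) ?_ ?_).symm.trans (map_smul _ _ _)
  · rw [← posSqrt_posSqrt_apply hQ]
    exact hR.apply_mem_ker_orthogonal _
  · rw [map_smul, ← h, ← posSqrt_posSqrt_apply hQ, ← posSqrt_posSqrt_apply hQ,
      cmPinv, RangeSpace.apply_pinv]

/-- With `R = Q ^ (1/2)`, `f = R⁻¹ e` and `Q f = l f`, the vector `g = R f - √l f` satisfies `R g =
-√l g`; nonnegativity of `R` forces `g = 0`. -/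
theorem sqrt_smul_cmPinv_eigenvector (hQ : Q.IsPositive)
    (h : Q (cmIncl Q e) = l • cmIncl Q e) (hl : 0 < l) : √l • cmPinv Q e = cmIncl Q e := by
  have hR := posSqrt_isPositive hQ
  set f := cmPinv Q e with hf
  have hRf : posSqrt Q f = cmIncl Q e := RangeSpace.apply_pinv _ _
  have hQf : posSqrt Q (posSqrt Q f) = l • f := by
    rw [posSqrt_posSqrt_apply hQ, apply_cmPinv_eigenvector hQ h]
  set g := posSqrt Q f - √l • f with hg
  have hRg : posSqrt Q g = -(√l • g) := by
    rw [hg, map_sub, map_smul, hQf, smul_sub, smul_smul, Real.mul_self_sqrt hl.le]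
    abel
  have h1 := hR.inner_nonneg_left g
  rw [hRg, inner_neg_left, inner_smul_left, real_inner_self_eq_norm_sq] at h1
  have h2 : 0 < √l := Real.sqrt_pos.2 hl
  have h3 : ‖g‖ ^ 2 ≤ 0 := by
    simp only [conj_trivial] at h1
    nlinarith [sq_nonneg ‖g‖]
  have h4 : g = 0 := by
    rw [← norm_eq_zero]
    exact pow_eq_zero_iff (two_ne_zero) |>.1 (le_antisymm h3 (sq_nonneg _))
  rw [← hRf]
  exact (sub_eq_zero.1 h4).symm

end Eigenvector

/-- Since `⟪U z, x⟫ = ⟪z, i_s⋆ U⋆ x⟫` is at most `‖z‖ ‖i_t⋆ x‖`, `exists_apply_eq_of_abs_inner_le`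
puts `U z` in the range of `i_t` with norm at most `‖z‖`. Injectivity of `i_t` makes the choice
linear. -/
theorem exists_restriction {Qs Qt : E →L[ℝ] E} (U : E →L[ℝ] E)
    (h : ∀ x, ‖(cmInclL Qs).adjoint (U.adjoint x)‖ ≤ ‖(cmInclL Qt).adjoint x‖) :
    ∃ V : CameronMartin Qs →L[ℝ] CameronMartin Qt, ‖V‖ ≤ 1 ∧
      ∀ z, cmIncl Qt (V z) = U (cmIncl Qs z) := by
  have key : ∀ z : CameronMartin Qs, ∃ y : CameronMartin Qt,
      cmInclL Qt y = U (cmInclL Qs z) ∧ ‖y‖ ≤ ‖z‖ := by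
    intro z
    refine exists_apply_eq_of_abs_inner_le _ (norm_nonneg z) fun x => ?_
    rw [← ContinuousLinearMap.adjoint_inner_right, ← ContinuousLinearMap.adjoint_inner_right]
    exact (abs_real_inner_le_norm _ _).trans (mul_le_mul_of_nonneg_left (h x) (norm_nonneg z))
  choose V hV hVn using key
  let V' : CameronMartin Qs →ₗ[ℝ] CameronMartin Qt :=
    { toFun := V
      map_add' := fun x y => cmInclL_injective Qt (by simp only [map_add, hV])
      map_smul' := fun c x => cmInclL_injective Qt (by simp only [map_smul, hV, RingHom.id_apply]) }
  refine ⟨V'.mkContinuous 1 fun z => by rw [one_mul]; exact hVn z,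
    V'.mkContinuous_norm_le zero_le_one _, hV⟩

end CameronMartinSpace

/-! ### Random series in `L²` and their characteristic functions. -/

section L2Series

variable {Ω : Type*} [MeasurableSpace Ω] {P : Measure Ω}
  {F : Type*} [NormedAddCommGroup F] [InnerProductSpace ℝ F]

theorem _root_.MeasureTheory.MemLp.smul_const_right {ξ : Ω → ℝ} (h : MemLp ξ 2 P) (a : F) :
    MemLp (fun ω => ξ ω • a) 2 P :=
  (memLp_top_const a).smul (r := 2) h

/-- The isometry `a ↦ ξ a` of `F` into `L²(P; F)`, for `ξ` of norm one in `L²(P)`. -/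
def smulIsometry (ξ : Ω → ℝ) (h : MemLp ξ 2 P) (h1 : ∫ ω, ξ ω * ξ ω ∂P = 1) :
    F →ₗᵢ[ℝ] Lp F 2 P where
  toFun a := (h.smul_const_right a).toLp _
  map_add' a b := by
    rw [← MemLp.toLp_add]
    congr 1
    ext ω
    simp
  map_smul' c a := by
    rw [RingHom.id_apply, ← MemLp.toLp_const_smul]
    congr 1
    ext ω
    exact smul_comm _ _ _
  norm_map' a := by
    have h2 := h.smul_const_right a
    change ‖h2.toLp _‖ = ‖a‖
    rw [← sq_eq_sq₀ (norm_nonneg _) (norm_nonneg _), ← real_inner_self_eq_norm_sq, L2.inner_def,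
      ← real_inner_self_eq_norm_sq]
    have : (fun ω => ⟪h2.toLp _ ω, h2.toLp _ ω⟫) =ᵐ[P] fun ω => (ξ ω * ξ ω) * ⟪a, a⟫ := by
      filter_upwards [h2.coeFn_toLp] with ω hω
      rw [hω]
      simp only [inner_smul_left, inner_smul_right, conj_trivial]
      ring
    rw [integral_congr_ae this, integral_mul_const, h1, one_mul]

theorem smulIsometry_coeFn (ξ : Ω → ℝ) (h : MemLp ξ 2 P) (h1 : ∫ ω, ξ ω * ξ ω ∂P = 1) (a : F) :
    smulIsometry ξ h h1 a =ᵐ[P] fun ω => ξ ω • a :=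
  (h.smul_const_right a).coeFn_toLp

/-- Series with orthonormal random coefficients and square summable vectors converge in `L²`. -/
theorem exists_tendsto_eLpNorm_sum_smul [CompleteSpace F] {ι : Type*} (ξ : ι → Ω → ℝ)
    (h : ∀ i, MemLp (ξ i) 2 P) (h1 : ∀ i, ∫ ω, ξ i ω * ξ i ω ∂P = 1)
    (h0 : ∀ i j, i ≠ j → ∫ ω, ξ i ω * ξ j ω ∂P = 0) (a : ι → F) (ha : ∑' i, ‖a i‖ₑ ^ 2 ≠ ∞) :
    ∃ Z : Ω → F, MemLp Z 2 P ∧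
      Tendsto (fun J : Finset ι => eLpNorm (fun ω => Z ω - ∑ i ∈ J, ξ i ω • a i) 2 P)
        atTop (𝓝 0) := by
  let V : ι → F →ₗᵢ[ℝ] Lp F 2 P := fun i => smulIsometry (ξ i) (h i) (h1 i)
  -- Orthogonal coefficients make the copies `ξᵢ F` of `F` mutually orthogonal in `L²(P; F)`, so
  -- convergence reduces to summability of `‖aᵢ‖²`.
  have hV : OrthogonalFamily ℝ (fun _ : ι => F) V := by
    intro i j hij v w
    rw [L2.inner_def]
    have : (fun ω => ⟪V i v ω, V j w ω⟫) =ᵐ[P] fun ω => (ξ i ω * ξ j ω) * ⟪v, w⟫ := by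
      filter_upwards [smulIsometry_coeFn (ξ i) (h i) (h1 i) v,
        smulIsometry_coeFn (ξ j) (h j) (h1 j) w] with ω hv hw
      simp only [V, hv, hw, inner_smul_left, inner_smul_right, conj_trivial]
      ring
    rw [integral_congr_ae this, integral_mul_const, h0 i j hij, zero_mul]
  have hs : Summable fun i => ‖a i‖ ^ 2 := by
    have := ENNReal.summable_toReal ha
    simpa using this
  have hsum := ((hV.summable_iff_norm_sq_summable a).2 hs).hasSum
  refine ⟨(∑' i, V i (a i) : Lp F 2 P), Lp.memLp _, ?_⟩
  rw [HasSum, SummationFilter.unconditional_filter, Lp.tendsto_Lp_iff_tendsto_eLpNorm'] at hsum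
  refine hsum.congr fun J => ?_
  rw [eLpNorm_sub_comm]
  refine eLpNorm_congr_ae ?_
  have h3 : ∀ᵐ ω ∂P, ∀ i ∈ J, V i (a i) ω = ξ i ω • a i :=
    (ae_ball_iff J.countable_toSet).2 fun i _ => smulIsometry_coeFn (ξ i) (h i) (h1 i) (a i)
  filter_upwards [h3, Lp.coeFn_finsetSum (s := J) (f := fun i => V i (a i))] with ω hω hω'
  simp only [Pi.sub_apply]
  rw [hω', Finset.sum_apply, Finset.sum_congr rfl hω]

theorem _root_.Complex.enorm_exp_ofReal_mul_I_sub_le (a b : ℝ) :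
    ‖Complex.exp (a * Complex.I) - Complex.exp (b * Complex.I)‖ₑ ≤ ‖a - b‖ₑ := by
  have h : Complex.exp (a * Complex.I) - Complex.exp (b * Complex.I) =
      Complex.exp (b * Complex.I) * (Complex.exp (Complex.I * ((a - b : ℝ) : ℂ)) - 1) := by
    rw [mul_sub, ← Complex.exp_add, mul_one]
    congr 2
    push_cast
    ring
  rw [h, enorm_mul]
  have h2 : ‖Complex.exp (b * Complex.I)‖ₑ = 1 := by
    rw [← enorm_norm, Complex.norm_exp_ofReal_mul_I]
    simp
  rw [h2, one_mul]
  exact Real.enorm_exp_I_mul_ofReal_sub_one_le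

variable [IsProbabilityMeasure P] [MeasurableSpace F] [BorelSpace F] [SecondCountableTopology F]

/-- Characteristic functions pass to the limit in `L²`. -/
theorem tendsto_charFun_map_of_tendsto_eLpNorm {κ : Type*} {l : Filter κ} {Z : Ω → F}
    {Y : κ → Ω → F} (hZ : AEMeasurable Z P) (hY : ∀ k, AEMeasurable (Y k) P)
    (h : Tendsto (fun k => eLpNorm (fun ω => Z ω - Y k ω) 2 P) l (𝓝 0)) (t : F) :
    Tendsto (fun k => charFun (P.map (Y k)) t) l (𝓝 (charFun (P.map Z) t)) := by
  have hcf : ∀ W : Ω → F, AEMeasurable W P →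
      charFun (P.map W) t = ∫ ω, Complex.exp (⟪W ω, t⟫ * Complex.I) ∂P := by
    intro W hW
    rw [charFun_apply, integral_map hW (by fun_prop)]
  have hint : ∀ W : Ω → F, AEMeasurable W P →
      Integrable (fun ω => Complex.exp (⟪W ω, t⟫ * Complex.I)) P := by
    intro W hW
    refine Integrable.of_bound (C := 1) ?_ (.of_forall fun ω => ?_)
    · have : Continuous fun y : F => Complex.exp (⟪y, t⟫ * Complex.I) := by fun_prop
      exact (this.measurable.comp_aemeasurable hW).aestronglyMeasurable
    · rw [Complex.norm_exp_ofReal_mul_I]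
  have hle : ∀ k, edist (charFun (P.map (Y k)) t) (charFun (P.map Z) t) ≤
      ‖t‖ₑ * eLpNorm (fun ω => Z ω - Y k ω) 2 P := by
    intro k
    rw [edist_comm, edist_eq_enorm_sub, hcf _ hZ, hcf _ (hY k),
      ← integral_sub (hint _ hZ) (hint _ (hY k))]
    refine (enorm_integral_le_lintegral_enorm _).trans ?_
    calc ∫⁻ ω, ‖Complex.exp (⟪Z ω, t⟫ * Complex.I) - Complex.exp (⟪Y k ω, t⟫ * Complex.I)‖ₑ ∂P
        ≤ ∫⁻ ω, ‖t‖ₑ * ‖Z ω - Y k ω‖ₑ ∂P := by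
          refine lintegral_mono fun ω => ?_
          refine (Complex.enorm_exp_ofReal_mul_I_sub_le _ _).trans ?_
          rw [← inner_sub_left, ← enorm_norm t, ← enorm_norm (Z ω - Y k ω), ← enorm_mul,
            enorm_le_iff_norm_le]
          simpa [mul_comm] using abs_real_inner_le_norm (Z ω - Y k ω) t
      _ = ‖t‖ₑ * eLpNorm (fun ω => Z ω - Y k ω) 1 P := by
          rw [lintegral_const_mul' _ _ (by simp), eLpNorm_one_eq_lintegral_enorm]
      _ ≤ _ := by
          gcongr
          exact eLpNorm_le_eLpNorm_of_exponent_le one_le_two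
            (hZ.sub (hY k)).aestronglyMeasurable
  rw [tendsto_iff_edist_tendsto_0]
  refine tendsto_of_tendsto_of_tendsto_of_le_of_le tendsto_const_nhds ?_ (fun _ => zero_le) hle
  simpa using ENNReal.Tendsto.const_mul h (.inr (by simp : ‖t‖ₑ ≠ ∞))

end L2Series

/-! ### Existence and uniqueness of Gaussian measures with trace-class covariance. -/

section Gaussian

variable {X : Type u} [NormedAddCommGroup X] [InnerProductSpace ℝ X] [CompleteSpace X]
  [MeasurableSpace X] [BorelSpace X] [SecondCountableTopology X] {μ ν : Measure X} {a : X}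
  {Q : X →L[ℝ] X}

theorem isGaussianWith_of_charFun [IsFiniteMeasure μ] (hQ : Q.IsPositive)
    (h : ∀ t, charFun μ t = Complex.exp (⟪t, a⟫ * Complex.I - ⟪Q t, t⟫ / 2)) :
    IsGaussianWith μ a Q := by
  set f : X →L[ℝ] X →L[ℝ] ℝ := innerSL ℝ ∘L Q with hf
  have hpos : f.toBilinForm.IsPosSemidef :=
    ⟨⟨fun x y => by
      change ⟪Q x, y⟫ = ⟪Q y, x⟫
      rw [hQ.inner_left_eq_inner_right, real_inner_comm]⟩, ⟨fun x => hQ.inner_nonneg_left x⟩⟩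
  have h' : ∀ t, charFun μ t = Complex.exp (⟪t, a⟫ * Complex.I - f t t / 2) := h
  obtain ⟨h1, h2⟩ := gaussian_charFun_congr a f hpos h'
  exact ⟨isGaussian_iff_gaussian_charFun.2 ⟨a, f, hpos, h'⟩, h1.symm, fun x y => by rw [← h2]; rfl⟩

theorem IsGaussianWith.charFun_eq (h : IsGaussianWith μ a Q) (t : X) :
    charFun μ t = Complex.exp (⟪t, a⟫ * Complex.I - ⟪Q t, t⟫ / 2) := by
  obtain ⟨h1, h2, h3⟩ := h
  rw [IsGaussian.charFun_eq', h3]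
  simp [h2]

theorem IsGaussianWith.unique (hμ : IsGaussianWith μ a Q) (hν : IsGaussianWith ν a Q) : μ = ν := by
  have := hμ.1
  have := hν.1
  refine Measure.ext_of_charFun (funext fun t => ?_)
  rw [hμ.charFun_eq, hν.charFun_eq]

theorem IsGaussianWith.isGaussianWith_gaussianMeasure (h : IsGaussianWith μ a Q) :
    IsGaussianWith (gaussianMeasure a Q) a Q := by
  have h' : ∃ μ : Measure X, IsGaussianWith μ a Q := ⟨μ, h⟩
  rw [gaussianMeasure, dif_pos h']
  exact h'.choose_spec

theorem IsGaussianWith.gaussianMeasure_eq (h : IsGaussianWith μ a Q) : gaussianMeasure a Q = μ :=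
  h.isGaussianWith_gaussianMeasure.unique h

theorem IsGaussianWith.map_const_add (h : IsGaussianWith μ 0 Q) (hQ : Q.IsPositive) :
    IsGaussianWith (μ.map fun x => a + x) a Q := by
  have := h.1
  refine isGaussianWith_of_charFun hQ fun t => ?_
  rw [charFun_map_const_add, h.charFun_eq, ← Complex.exp_add, real_inner_comm a t]
  simp
  ring_nf

/-- Laws of `L²` limits of finite Gaussian sums. -/
theorem isGaussianWith_map_of_tendsto {Ω : Type*} [MeasurableSpace Ω] {P : Measure Ω}
    [IsProbabilityMeasure P] {ι : Type*} (ξ : ι → Ω → ℝ) (hξ : ∀ i, AEMeasurable (ξ i) P)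
    (v : ι → X) {Z : Ω → X} (hQ : Q.IsPositive)
    (hZ : AEMeasurable Z P)
    (hlim : Tendsto (fun J : Finset ι => eLpNorm (fun ω => Z ω - ∑ i ∈ J, ξ i ω • v i) 2 P)
        atTop (𝓝 0))
    (hcf : ∀ (J : Finset ι) t, charFun (P.map fun ω => ∑ i ∈ J, ξ i ω • v i) t =
      Complex.exp (-((∑ i ∈ J, ⟪v i, t⟫ ^ 2 : ℝ) / 2)))
    (hv : ∀ t, HasSum (fun i => ⟪v i, t⟫ ^ 2) ⟪Q t, t⟫) :
    IsGaussianWith (P.map Z) 0 Q := by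
  have := Measure.isProbabilityMeasure_map hZ
  refine isGaussianWith_of_charFun hQ fun t => ?_
  have h1 := tendsto_charFun_map_of_tendsto_eLpNorm hZ (fun J : Finset ι =>
    Finset.aemeasurable_fun_sum J fun i _ => (hξ i).smul_const (v i)) hlim t
  refine tendsto_nhds_unique h1 ?_
  simp_rw [hcf]
  rw [inner_zero_right, Complex.ofReal_zero, zero_mul, zero_sub]
  have h2 : Continuous fun c : ℝ => Complex.exp (-((c : ℂ) / 2)) := by fun_prop
  exact (h2.tendsto _).comp (hv t)

theorem hasSum_inner_cmInclL_sq (hQ : Q.IsPositive) {κ : Type*}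
    (e : HilbertBasis κ ℝ (CameronMartin Q)) (t : X) :
    HasSum (fun k => ⟪cmInclL Q (e k), t⟫ ^ 2) ⟪Q t, t⟫ := by
  have h := e.hasSum_inner_mul_inner ((cmInclL Q).adjoint t) ((cmInclL Q).adjoint t)
  rw [real_inner_self_eq_norm_sq, norm_cmInclL_adjoint_sq hQ] at h
  refine h.congr_fun ?_
  intro k
  rw [ContinuousLinearMap.adjoint_inner_left, ContinuousLinearMap.adjoint_inner_right,
    real_inner_comm, sq]

/-- The measure is the law of `∑ ωᵢ i(eᵢ)`, for independent standard Gaussian `ωᵢ` and an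
orthonormal basis `e` of the Cameron–Martin space; the series converges in `L²` because `∑ ‖i(eᵢ)‖²`
is the trace. -/
theorem exists_isGaussianWith_zero (hQ : Q.IsPositive) (htr : posTrace Q ≠ ∞) :
    ∃ μ : Measure X, IsGaussianWith μ 0 Q := by
  obtain ⟨w, e, -⟩ := exists_hilbertBasis ℝ (CameronMartin Q)
  let P : Measure (w → ℝ) := Measure.infinitePi fun _ => gaussianReal 0 1
  have hlaw : ∀ i, P.map (fun ω => ω i) = gaussianReal 0 1 := fun i =>
    Measure.infinitePi_map_eval _ i
  have hm : ∀ i : w, Measurable fun ω : w → ℝ => ω i := fun i => measurable_pi_apply i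
  have hind : iIndepFun (fun (i : w) (ω : w → ℝ) => ω i) P :=
    iIndepFun_infinitePi (X := fun _ x => x) fun _ => measurable_id
  have hL2 : ∀ i : w, MemLp (fun ω : w → ℝ => ω i) 2 P := fun i => by
    have : MemLp id 2 (P.map fun ω : w → ℝ => ω i) := by
      rw [hlaw]
      exact memLp_id_gaussianReal 2
    exact (memLp_map_measure_iff aestronglyMeasurable_id (hm i).aemeasurable).1 this
  have hmean : ∀ i : w, ∫ ω, ω i ∂P = 0 := fun i => by
    have : ∫ x, x ∂(P.map fun ω : w → ℝ => ω i) = 0 := by rw [hlaw]; simp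
    rwa [integral_map (hm i).aemeasurable (by fun_prop)] at this
  obtain ⟨Z, hZ, hlim⟩ := exists_tendsto_eLpNorm_sum_smul (P := P) (fun (i : w) ω => ω i) hL2
    (fun i => by
      have : Var[fun x => x; P.map fun ω : w → ℝ => ω i] = 1 := by
        rw [hlaw]
        simp
      rw [variance_map measurable_id'.aemeasurable (hm i).aemeasurable, Function.comp_def,
        variance_of_integral_eq_zero (hm i).aemeasurable (hmean i)] at this
      simpa [sq] using this)
    (fun i j hij => by
      have := (hind.indepFun hij).integral_fun_mul_eq_mul_integral
        (hm i).aestronglyMeasurable (hm j).aestronglyMeasurable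
      rw [this, hmean, zero_mul])
    (fun i => cmInclL Q (e i)) (by rwa [tsum_enorm_cmInclL_sq hQ e])
  refine ⟨P.map Z, isGaussianWith_map_of_tendsto _ (fun i => (hm i).aemeasurable) _ hQ
    hZ.1.aemeasurable hlim (fun J t => ?_) (hasSum_inner_cmInclL_sq hQ e)⟩
  have hi : iIndepFun (fun (i : w) (ω : w → ℝ) => ω i • cmInclL Q (e i)) P :=
    hind.comp (fun i (x : ℝ) => x • cmInclL Q (e i)) fun i => by fun_prop
  have hms : ∀ i : w, Measurable fun ω : w → ℝ => ω i • cmInclL Q (e i) := fun i =>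
    (hm i).smul_const _
  rw [(hi.restrict J).charFun_map_fun_finsetSum_eq_prod fun i _ => (hms i).aemeasurable,
    Finset.prod_apply]
  have hone : ∀ i : w, charFun (P.map fun ω : w → ℝ => ω i • cmInclL Q (e i)) t =
      Complex.exp (-((⟪cmInclL Q (e i), t⟫ ^ 2 : ℝ) / 2)) := by
    intro i
    have h1 : charFun (P.map fun ω : w → ℝ => ω i • cmInclL Q (e i)) t =
        charFun (P.map fun ω : w → ℝ => ω i) ⟪cmInclL Q (e i), t⟫ := by
      rw [charFun_apply, charFun_apply, integral_map (hms i).aemeasurable (by fun_prop),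
        integral_map (hm i).aemeasurable (by fun_prop)]
      simp only [inner_smul_left, conj_trivial, RCLike.inner_apply]
      simp only [mul_comm]
    rw [h1, hlaw, charFun_gaussianReal]
    simp
  simp_rw [hone]
  rw [← Complex.exp_sum]
  congr 1
  push_cast
  rw [Finset.sum_neg_distrib, Finset.sum_div]

theorem isGaussianWith_gaussianMeasure (hQ : Q.IsPositive) (htr : posTrace Q ≠ ∞) (a : X) :
    IsGaussianWith (gaussianMeasure a Q) a Q :=
  ((exists_isGaussianWith_zero hQ htr).choose_spec.map_const_add
    hQ).isGaussianWith_gaussianMeasure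

theorem gaussianMeasure_eq_map (hQ : Q.IsPositive) (htr : posTrace Q ≠ ∞) (a : X) :
    gaussianMeasure a Q = (gaussianMeasure 0 Q).map fun x => a + x :=
  ((isGaussianWith_gaussianMeasure hQ htr 0).map_const_add hQ).gaussianMeasure_eq

end Gaussian

/-- Orthonormal vectors are at distance `√2`, so the balls of radius `1/2` around them are disjoint.
Countability is what permits exchanging sums over a basis with integrals. -/
theorem _root_.Orthonormal.countable {E ι : Type*} [NormedAddCommGroup E] [InnerProductSpace ℝ E]
    [TopologicalSpace.SeparableSpace E] {v : ι → E} (hv : Orthonormal ℝ v) : Countable ι := by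
  refine Pairwise.countable_of_isOpen_disjoint (s := fun i => Metric.ball (v i) (1 / 2)) ?_
    (fun _ => Metric.isOpen_ball) fun i => ⟨v i, by simp⟩
  intro i j hij
  refine Metric.ball_disjoint_ball ?_
  have h1 : ‖v i - v j‖ ^ 2 = 2 := by
    rw [norm_sub_sq_real, hv.2 hij, hv.1 i, hv.1 j]
    norm_num
  rw [dist_eq_norm]
  nlinarith [norm_nonneg (v i - v j)]

/-! ### Linear versions of measurable extensions: existence, uniqueness, law. -/

section LinearVersions

variable {X : Type u} [NormedAddCommGroup X] [InnerProductSpace ℝ X] [CompleteSpace X]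
  [MeasurableSpace X] [BorelSpace X] [SecondCountableTopology X]

section Moments

variable {μ : Measure X} {Q : X →L[ℝ] X}

theorem IsGaussianWith.memLp_inner (h : IsGaussianWith μ 0 Q) (u : X) :
    MemLp (fun x => ⟪u, x⟫) 2 μ := by
  have := h.1
  exact IsGaussian.memLp_dual μ (innerSL ℝ u) 2 (by simp)

theorem IsGaussianWith.integral_inner_mul_inner (h : IsGaussianWith μ 0 Q) (u v : X) :
    ∫ x, ⟪u, x⟫ * ⟪v, x⟫ ∂μ = ⟪Q u, v⟫ := by
  obtain ⟨h1, h2, h3⟩ := h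
  rw [← h3, covarianceBilin_apply IsGaussian.memLp_two_id]
  simp [h2]

theorem IsGaussianWith.lintegral_enorm_inner_sq (h : IsGaussianWith μ 0 Q) (u : X) :
    ∫⁻ x, ‖⟪u, x⟫‖ₑ ^ 2 ∂μ = ENNReal.ofReal ⟪Q u, u⟫ := by
  have hint : Integrable (fun x => ⟪u, x⟫ * ⟪u, x⟫) μ :=
    (h.memLp_inner u).integrable_mul (h.memLp_inner u)
  rw [← h.integral_inner_mul_inner, ofReal_integral_eq_lintegral_ofReal hint
    (.of_forall fun x => mul_self_nonneg _)]
  refine lintegral_congr fun x => ?_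
  rw [← sq, ← Real.enorm_of_nonneg (sq_nonneg _), enorm_pow]

/-- The second moment of a bounded linear image of a centered Gaussian measure. -/
theorem IsGaussianWith.lintegral_enorm_apply_sq (h : IsGaussianWith μ 0 Q) (hQ : Q.IsPositive)
    (S : X →L[ℝ] X) {κ : Type*} (e : HilbertBasis κ ℝ (CameronMartin Q)) :
    ∫⁻ x, ‖S x‖ₑ ^ 2 ∂μ = ∑' k, ‖S (cmInclL Q (e k))‖ₑ ^ 2 := by
  have : Countable (basisSet X) := (basis X).orthonormal.countable
  have h1 : ∀ x, ‖S x‖ₑ ^ 2 = ∑' i, ‖⟪S.adjoint (basis X i), x⟫‖ₑ ^ 2 := fun x => by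
    rw [← tsum_enorm_inner_sq (basis X)]
    exact tsum_congr fun i => by rw [ContinuousLinearMap.adjoint_inner_left]
  rw [lintegral_congr h1, lintegral_tsum fun i => by fun_prop]
  simp_rw [h.lintegral_enorm_inner_sq, ← enorm_cmInclL_adjoint_sq hQ]
  have h2 := tsum_enorm_apply_sq_eq_adjoint e (basis X) (S ∘L cmInclL Q)
  rw [ContinuousLinearMap.adjoint_comp] at h2
  exact h2.symm

end Moments

variable {Qμ Qν : X →L[ℝ] X}

/-- `T : H_μ → H_ν` followed by the inclusion of `H_ν` is a Hilbert–Schmidt operator. -/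
theorem tsum_enorm_cmInclL_apply_sq_ne_top (hν : Qν.IsPositive) (htrν : posTrace Qν ≠ ∞)
    (T : CameronMartin Qμ →L[ℝ] CameronMartin Qν) {κ : Type*}
    (e : HilbertBasis κ ℝ (CameronMartin Qμ)) :
    ∑' k, ‖cmInclL Qν (T (e k))‖ₑ ^ 2 ≠ ∞ := by
  have h2 := tsum_enorm_apply_sq_eq_adjoint e (basis X) (cmInclL Qν ∘L T)
  rw [ContinuousLinearMap.adjoint_comp] at h2
  simp only [ContinuousLinearMap.comp_apply] at h2
  rw [h2]
  have h3 : ∀ i, ‖T.adjoint ((cmInclL Qν).adjoint (basis X i))‖ₑ ^ 2 ≤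
      ‖T.adjoint‖ₑ ^ 2 * ‖(cmInclL Qν).adjoint (basis X i)‖ₑ ^ 2 := fun i => by
    rw [← mul_pow]
    gcongr
    exact ContinuousLinearMap.le_opENorm _ _
  refine ((ENNReal.tsum_le_tsum h3).trans_lt ?_).ne
  rw [ENNReal.tsum_mul_left, ← posTrace_eq_tsum hν]
  exact ENNReal.mul_lt_top (by simp) htrν.lt_top

section Eigenbasis

variable {w : Set (CameronMartin Qμ)} (e : HilbertBasis w ℝ (CameronMartin Qμ)) {lam : w → ℝ}

theorem eigenbasis_lam_pos (hμ : Qμ.IsPositive)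
    (he : ∀ i, Qμ (cmIncl Qμ (e i)) = lam i • cmIncl Qμ (e i)) (i : w) : 0 < lam i :=
  eigenvalue_pos hμ (he i) (e.orthonormal.1 i)

theorem inner_cmPinv_eigenbasis (i j : w) [Decidable (i = j)] :
    ⟪cmPinv Qμ (e i), cmPinv Qμ (e j)⟫ = if i = j then 1 else 0 := by
  classical
  rw [← RangeSpace.inner_def]
  convert orthonormal_iff_ite.1 e.orthonormal i j

variable {μ : Measure X}

theorem aemeasurable_coord (i : w) :
    AEMeasurable (fun x => ⟪cmPinv Qμ (e i), x⟫ / √(lam i)) μ := by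
  fun_prop

theorem memLp_coord (h : IsGaussianWith μ 0 Qμ) (i : w) :
    MemLp (fun x => ⟪cmPinv Qμ (e i), x⟫ / √(lam i)) 2 μ := by
  simp_rw [div_eq_mul_inv]
  exact (h.memLp_inner _).mul_const _

theorem integral_coord_mul_coord (h : IsGaussianWith μ 0 Qμ) (hμ : Qμ.IsPositive)
    (he : ∀ i, Qμ (cmIncl Qμ (e i)) = lam i • cmIncl Qμ (e i)) (i j : w) [Decidable (i = j)] :
    ∫ x, (⟪cmPinv Qμ (e i), x⟫ / √(lam i)) * (⟪cmPinv Qμ (e j), x⟫ / √(lam j)) ∂μ =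
      if i = j then 1 else 0 := by
  simp_rw [div_mul_div_comm]
  rw [integral_div, h.integral_inner_mul_inner, apply_cmPinv_eigenvector hμ (he i),
    inner_smul_left, inner_cmPinv_eigenbasis]
  have := eigenbasis_lam_pos e hμ he i
  split_ifs with hij
  · subst hij
    rw [Real.mul_self_sqrt this.le]
    simp [this.ne']
  · simp

/-- Independence of the coordinates is not needed: paired with `t`, the sum is a single functional
`⟪·, y⟫`, whose variance `⟪Qμ y, y⟫` is read off from the eigenvector relations. -/
theorem charFun_map_sum_coord_smul (h : IsGaussianWith μ 0 Qμ) (hμ : Qμ.IsPositive)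
    (he : ∀ i, Qμ (cmIncl Qμ (e i)) = lam i • cmIncl Qμ (e i)) (v : w → X) (J : Finset w) (t : X) :
    charFun (μ.map fun x => ∑ i ∈ J, (⟪cmPinv Qμ (e i), x⟫ / √(lam i)) • v i) t =
      Complex.exp (-((∑ i ∈ J, ⟪v i, t⟫ ^ 2 : ℝ) / 2)) := by
  classical
  set y : X := ∑ i ∈ J, (⟪v i, t⟫ / √(lam i)) • cmPinv Qμ (e i) with hy
  have h1 : ∀ x, ⟪∑ i ∈ J, (⟪cmPinv Qμ (e i), x⟫ / √(lam i)) • v i, t⟫ = ⟪x, y⟫ := by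
    intro x
    rw [sum_inner, hy, inner_sum]
    refine Finset.sum_congr rfl fun i _ => ?_
    rw [inner_smul_left, inner_smul_right, conj_trivial, real_inner_comm x]
    ring
  have h2 : ⟪Qμ y, y⟫ = ∑ i ∈ J, ⟪v i, t⟫ ^ 2 := by
    have hQy : Qμ y = ∑ i ∈ J, (⟪v i, t⟫ / √(lam i) * lam i) • cmPinv Qμ (e i) := by
      rw [hy, map_sum]
      refine Finset.sum_congr rfl fun i _ => ?_
      rw [map_smul, apply_cmPinv_eigenvector hμ (he i), smul_smul]
    rw [hQy, sum_inner]
    refine Finset.sum_congr rfl fun i hi => ?_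
    rw [hy, inner_sum, Finset.sum_eq_single i]
    · have := eigenbasis_lam_pos e hμ he i
      have hs := Real.mul_self_sqrt this.le
      have hs0 : √(lam i) ≠ 0 := (Real.sqrt_pos.2 this).ne'
      rw [inner_smul_left, inner_smul_right, inner_cmPinv_eigenbasis, if_pos rfl, conj_trivial]
      nth_rewrite 2 [← hs]
      field_simp
    · intro j _ hj
      rw [inner_smul_left, inner_smul_right, inner_cmPinv_eigenbasis, if_neg hj.symm]
      simp
    · exact fun hn => absurd hi hn
  rw [charFun_apply, integral_map (Finset.aemeasurable_fun_sum J fun i _ =>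
    (aemeasurable_coord e i).smul_const (v i)) (by fun_prop)]
  simp_rw [h1]
  rw [← charFun_apply, h.charFun_eq, h2]
  simp

/-- A bounded extension is the `L²` limit of the finite approximations, along any eigenbasis. -/
theorem tendsto_eLpNorm_sub_finiteApprox (h : IsGaussianWith μ 0 Qμ) (hμ : Qμ.IsPositive)
    (hν : Qν.IsPositive) (htrν : posTrace Qν ≠ ∞)
    (he : ∀ i, Qμ (cmIncl Qμ (e i)) = lam i • cmIncl Qμ (e i))
    {T : CameronMartin Qμ →L[ℝ] CameronMartin Qν} {A : X →L[ℝ] X}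
    (hA : ∀ z, A (cmIncl Qμ z) = cmIncl Qν (T z)) :
    Tendsto (fun J : Finset w => eLpNorm (fun x => A x - finiteApprox T e lam J x) 2 μ)
      atTop (𝓝 0) := by
  classical
  let S : Finset w → X →L[ℝ] X := fun J => A - ∑ i ∈ J,
    (innerSL ℝ ((√(lam i))⁻¹ • cmPinv Qμ (e i))).smulRight (cmIncl Qν (T (e i)))
  have hS : ∀ J x, S J x = A x - finiteApprox T e lam J x := by
    intro J x
    simp only [S, finiteApprox, sub_apply, sum_apply, ContinuousLinearMap.smulRight_apply,
      innerSL_apply_apply, inner_smul_left, conj_trivial]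
    congr 1
    exact Finset.sum_congr rfl fun i _ => by rw [div_eq_inv_mul]
  -- The remainder kills the basis vectors indexed by `J` and acts as `T` on the others, so its
  -- second moment is a tail of the Hilbert–Schmidt sum of `T`.
  have hSe : ∀ J k, S J (cmInclL Qμ (e k)) = if k ∈ J then 0 else cmInclL Qν (T (e k)) := by
    intro J k
    have hk := eigenbasis_lam_pos e hμ he k
    have hk0 : √(lam k) ≠ 0 := (Real.sqrt_pos.2 hk).ne'
    rw [hS, finiteApprox, cmInclL_apply, hA]
    have : ∀ i, (⟪cmPinv Qμ (e i), cmIncl Qμ (e k)⟫ / √(lam i)) • cmIncl Qν (T (e i)) =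
        if i = k then cmIncl Qν (T (e k)) else 0 := by
      intro i
      rw [← sqrt_smul_cmPinv_eigenvector hμ (he k) hk, inner_smul_right, inner_cmPinv_eigenbasis]
      split_ifs with hik
      · subst hik
        rw [mul_one, div_self hk0, one_smul]
      · simp
    simp_rw [this, Finset.sum_ite_eq']
    split_ifs <;> simp
  have hnorm : ∀ J, eLpNorm (fun x => A x - finiteApprox T e lam J x) 2 μ =
      (∑' k : { k // k ∉ J }, ‖cmInclL Qν (T (e k))‖ₑ ^ 2) ^ (1 / 2 : ℝ) := by
    intro J
    simp_rw [← hS]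
    rw [eLpNorm_eq_lintegral_rpow_enorm_toReal two_ne_zero ENNReal.ofNat_ne_top]
    simp only [ENNReal.toReal_ofNat, ENNReal.rpow_ofNat]
    rw [h.lintegral_enorm_apply_sq hμ (S J) e]
    congr 1
    refine Eq.trans ?_ (tsum_subtype {k | k ∉ J} fun k => ‖cmInclL Qν (T (e k))‖ₑ ^ 2).symm
    refine tsum_congr fun k => ?_
    rw [hSe]
    by_cases hk : k ∈ J <;> simp [hk]
  simp_rw [hnorm]
  have := (ENNReal.tendsto_tsum_compl_atTop_zero
    (tsum_enorm_cmInclL_apply_sq_ne_top hν htrν T e)).ennrpow_const (1 / 2 : ℝ)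
  simpa using this

end Eigenbasis

/-- A limit of linear maps along a sequence, on the subspace where it exists, extended linearly. -/
theorem exists_linearMap_eq_of_tendsto {E F : Type*} [AddCommGroup E] [Module ℝ E]
    [NormedAddCommGroup F] [NormedSpace ℝ F] (f : ℕ → E →ₗ[ℝ] F) :
    ∃ g : E →ₗ[ℝ] F, ∀ x y, Tendsto (fun n => f n x) atTop (𝓝 y) → g x = y := by
  let V : Submodule ℝ E :=
    { carrier := {x | ∃ y, Tendsto (fun n => f n x) atTop (𝓝 y)}
      add_mem' := by
        rintro a b ⟨y, hy⟩ ⟨z, hz⟩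
        exact ⟨y + z, by simpa using hy.add hz⟩
      zero_mem' := ⟨0, by simp⟩
      smul_mem' := by
        rintro c a ⟨y, hy⟩
        exact ⟨c • y, by simpa using hy.const_smul c⟩ }
  choose l hl using fun x : V => x.2
  let L : V →ₗ[ℝ] F :=
    { toFun := l
      map_add' := fun a b => tendsto_nhds_unique (hl (a + b)) (by simpa using (hl a).add (hl b))
      map_smul' := fun c a =>
        tendsto_nhds_unique (hl (c • a)) (by simpa using (hl a).const_smul c) }
  -- A purely algebraic extension, with no continuity or measurability claimed.
  obtain ⟨g, hg⟩ := L.exists_extend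
  refine ⟨g, fun x y hy => ?_⟩
  have h1 : g x = l ⟨x, y, hy⟩ := LinearMap.congr_fun hg ⟨x, y, hy⟩
  rw [h1]
  exact tendsto_nhds_unique (hl ⟨x, y, hy⟩) hy

/-- A subsequence of the finite approximations converges almost everywhere to the `L²` limit `Z`.
Its pointwise limit is linear on the subspace where it exists and extends algebraically; the result
equals `Z` almost everywhere, hence is measurable for the completion. -/
theorem exists_isLinearVersion (hμ : Qμ.IsPositive) (htrμ : posTrace Qμ ≠ ∞)
    (hν : Qν.IsPositive) (htrν : posTrace Qν ≠ ∞)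
    (T : CameronMartin Qμ →L[ℝ] CameronMartin Qν) : ∃ F : X →ₗ[ℝ] X, IsLinearVersion T F := by
  classical
  have hG := isGaussianWith_gaussianMeasure hμ htrμ (0 : X)
  set μ := gaussianMeasure (0 : X) Qμ with hμdef
  obtain ⟨w, e, lam, he⟩ := exists_eigenbasis hμ htrμ
  obtain ⟨Z, hZ, hlim⟩ := exists_tendsto_eLpNorm_sum_smul (P := μ)
    (fun (i : w) x => ⟪cmPinv Qμ (e i), x⟫ / √(lam i)) (memLp_coord e hG)
    (fun i => by rw [integral_coord_mul_coord e hG hμ he, if_pos rfl])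
    (fun i j hij => by rw [integral_coord_mul_coord e hG hμ he, if_neg hij])
    (fun i => cmInclL Qν (T (e i))) (tsum_enorm_cmInclL_apply_sq_ne_top hν htrν T e)
  let f : Finset w → X →ₗ[ℝ] X := fun J => ∑ i ∈ J,
    ((innerSL ℝ ((√(lam i))⁻¹ • cmPinv Qμ (e i))).smulRight (cmIncl Qν (T (e i))) : X →L[ℝ] X)
  have hf : ∀ J x, f J x = finiteApprox T e lam J x := by
    intro J x
    simp only [f, finiteApprox, LinearMap.sum_apply, ContinuousLinearMap.coe_coe,
      ContinuousLinearMap.smulRight_apply, innerSL_apply_apply, inner_smul_left, conj_trivial]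
    exact Finset.sum_congr rfl fun i _ => by rw [div_eq_inv_mul]
  have hlim' : Tendsto (fun J : Finset w => eLpNorm (fun x => Z x - finiteApprox T e lam J x) 2 μ)
      atTop (𝓝 0) := hlim
  have hmeas : ∀ J, Measurable (finiteApprox T e lam J) := fun J => by
    unfold finiteApprox
    fun_prop
  have hsel : ∀ n : ℕ, ∃ J, eLpNorm (fun x => Z x - finiteApprox T e lam J x) 2 μ ≤
      ((n : ℝ≥0∞) + 1)⁻¹ := fun n =>
    (hlim'.eventually_le_const (ENNReal.inv_pos.2 (by finiteness))).exists
  choose J hJ using hsel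
  have hseq : Tendsto (fun n => eLpNorm (finiteApprox T e lam (J n) - Z) 2 μ) atTop (𝓝 0) := by
    refine tendsto_of_tendsto_of_tendsto_of_le_of_le tendsto_const_nhds
      ((tendsto_add_atTop_iff_nat 1).2 ENNReal.tendsto_inv_nat_nhds_zero) (fun _ => zero_le)
      fun n => ?_
    rw [eLpNorm_sub_comm, Nat.cast_add, Nat.cast_one]
    exact hJ n
  obtain ⟨ns, -, hns⟩ := (tendstoInMeasure_of_tendsto_eLpNorm two_ne_zero
    (fun n => (hmeas (J n)).aestronglyMeasurable) hZ.1 hseq).exists_seq_tendsto_ae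
  obtain ⟨F, hF⟩ := exists_linearMap_eq_of_tendsto fun n => f (J (ns n))
  have hFZ : F =ᵐ[μ] Z := by
    filter_upwards [hns] with x hx
    exact hF x _ (by simpa only [hf] using hx)
  refine ⟨F, hZ.1.aemeasurable.congr hFZ.symm, w, e, lam, he, hlim'.congr fun J => ?_⟩
  refine eLpNorm_congr_ae ?_
  filter_upwards [hFZ] with x hx
  rw [hx]

theorem isLinearVersion_of_forall_apply_eq (hμ : Qμ.IsPositive) (htrμ : posTrace Qμ ≠ ∞)
    (hν : Qν.IsPositive) (htrν : posTrace Qν ≠ ∞)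
    {T : CameronMartin Qμ →L[ℝ] CameronMartin Qν} {A : X →L[ℝ] X}
    (hA : ∀ z, A (cmIncl Qμ z) = cmIncl Qν (T z)) : IsLinearVersion T (A : X →ₗ[ℝ] X) := by
  obtain ⟨w, e, lam, he⟩ := exists_eigenbasis hμ htrμ
  exact ⟨A.continuous.measurable.aemeasurable, w, e, lam, he,
    tendsto_eLpNorm_sub_finiteApprox e (isGaussianWith_gaussianMeasure hμ htrμ 0) hμ hν htrν he hA⟩

theorem isLinearVersion_infExt (hμ : Qμ.IsPositive) (htrμ : posTrace Qμ ≠ ∞)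
    (hν : Qν.IsPositive) (htrν : posTrace Qν ≠ ∞)
    (T : CameronMartin Qμ →L[ℝ] CameronMartin Qν) : IsLinearVersion T (infExt T) := by
  unfold infExt
  split_ifs with h h'
  · exact isLinearVersion_of_forall_apply_eq hμ htrμ hν htrν h.choose_spec.1
  · exact h'.choose_spec
  · exact absurd (exists_isLinearVersion hμ htrμ hν htrν T) h'

/-- All linear versions agree almost everywhere with a bounded extension, if there is one. -/
theorem IsLinearVersion.ae_eq (hμ : Qμ.IsPositive) (htrμ : posTrace Qμ ≠ ∞)
    (hν : Qν.IsPositive) (htrν : posTrace Qν ≠ ∞)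
    {T : CameronMartin Qμ →L[ℝ] CameronMartin Qν} {A : X →L[ℝ] X}
    (hA : ∀ z, A (cmIncl Qμ z) = cmIncl Qν (T z)) {F : X →ₗ[ℝ] X} (hF : IsLinearVersion T F) :
    F =ᵐ[gaussianMeasure 0 Qμ] A := by
  obtain ⟨hFm, w, e, lam, he, hlim⟩ := hF
  have hA2 := tendsto_eLpNorm_sub_finiteApprox e (isGaussianWith_gaussianMeasure hμ htrμ 0)
    hμ hν htrν he hA
  have hmeas : ∀ J, Measurable (finiteApprox T e lam J) := fun J => by
    unfold finiteApprox
    fun_prop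
  have hAm : Measurable A := A.continuous.measurable
  have hle : ∀ J : Finset w, eLpNorm (fun x => F x - A x) 2 (gaussianMeasure 0 Qμ) ≤
      eLpNorm (fun x => F x - finiteApprox T e lam J x) 2 (gaussianMeasure 0 Qμ) +
      eLpNorm (fun x => A x - finiteApprox T e lam J x) 2 (gaussianMeasure 0 Qμ) := by
    intro J
    refine le_trans (le_of_eq ?_) (eLpNorm_sub_le
      (hFm.sub (hmeas J).aemeasurable).aestronglyMeasurable
      (hAm.sub (hmeas J)).aestronglyMeasurable one_le_two)
    congr 1
    ext x
    simp
  have h0 : eLpNorm (fun x => F x - A x) 2 (gaussianMeasure 0 Qμ) = 0 := by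
    have h1 := hlim.add hA2
    rw [add_zero] at h1
    exact le_antisymm (ge_of_tendsto' h1 hle) zero_le
  rw [eLpNorm_eq_zero_iff (f := fun x => F x - A x)
    (hFm.sub hAm.aemeasurable).aestronglyMeasurable two_ne_zero] at h0
  filter_upwards [h0] with x hx
  exact sub_eq_zero.1 hx

/-- The law of a linear version of `T_∞`. -/
theorem IsLinearVersion.isGaussianWith_map (hμ : Qμ.IsPositive) (htrμ : posTrace Qμ ≠ ∞)
    {T : CameronMartin Qμ →L[ℝ] CameronMartin Qν} {G : X →ₗ[ℝ] X} (hG : IsLinearVersion T G)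
    {R : X →L[ℝ] X} (hR : R.IsPositive)
    (hRT : ∀ t, ⟪R t, t⟫ = ‖T.adjoint ((cmInclL Qν).adjoint t)‖ ^ 2) :
    IsGaussianWith ((gaussianMeasure 0 Qμ).map G) 0 R := by
  obtain ⟨hGm, w, e, lam, he, hlim⟩ := hG
  have h := isGaussianWith_gaussianMeasure hμ htrμ (0 : X)
  have := h.1
  refine isGaussianWith_map_of_tendsto _ (fun i => aemeasurable_coord e i)
    (fun i => cmIncl Qν (T (e i))) hR hGm hlim
    (charFun_map_sum_coord_smul e h hμ he _) fun t => ?_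
  -- The squares `⟪i T eₖ, t⟫²` are the squared coordinates of `y` in the basis `e`, so Parseval
  -- sums them to the prescribed variance.
  set y := T.adjoint ((cmInclL Qν).adjoint t) with hy
  have h1 := e.hasSum_inner_mul_inner y y
  rw [real_inner_self_eq_norm_sq, ← hRT] at h1
  refine h1.congr_fun fun k => ?_
  rw [hy, ContinuousLinearMap.adjoint_inner_left, ContinuousLinearMap.adjoint_inner_right,
    ContinuousLinearMap.adjoint_inner_left, ContinuousLinearMap.adjoint_inner_right,
    real_inner_comm (cmInclL Qν (T (e k))) t, sq]
  rfl

/-- Composing `A` with the projection onto `(ker Qμ ^ (1/2))ᗮ` gives a bounded extension in the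
required sense, so `infExt` takes its first branch; two bounded operators equal on `H_μ` agree on
its closure. -/
theorem infExt_apply_of_mem_closure {T : CameronMartin Qμ →L[ℝ] CameronMartin Qν} {A : X →L[ℝ] X}
    (hμ : Qμ.IsPositive) (hA : ∀ z, A (cmIncl Qμ z) = cmIncl Qν (T z)) {x : X}
    (hx : x ∈ closure (range (cmIncl Qμ))) : infExt T x = A x := by
  have hcl : IsClosed ((LinearMap.ker (posSqrt Qμ : X →ₗ[ℝ] X) : Submodule ℝ X) : Set X) :=
    (posSqrt Qμ).isClosed_ker
  have : CompleteSpace (LinearMap.ker (posSqrt Qμ : X →ₗ[ℝ] X)) := hcl.completeSpace_coe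
  set K := (LinearMap.ker (posSqrt Qμ : X →ₗ[ℝ] X))ᗮ with hK
  have hex : ∃ B : X →L[ℝ] X, IsBoundedExtension T B := by
    refine ⟨A ∘L K.starProjection, fun z => ?_, fun y hy => ?_⟩
    · rw [ContinuousLinearMap.comp_apply, Submodule.starProjection_eq_self_iff.2, hA]
      rw [cmIncl, ← RangeSpace.apply_pinv]
      exact (posSqrt_isPositive hμ).apply_mem_ker_orthogonal _
    · rw [ContinuousLinearMap.comp_apply, (Submodule.starProjection_apply_eq_zero_iff K).2, map_zero]
      rw [hK]
      exact Submodule.le_orthogonal_orthogonal _ hy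
  rw [infExt, dif_pos hex]
  refine (Set.EqOn.closure (s := range (cmIncl Qμ)) ?_ hex.choose.continuous A.continuous) hx
  rintro _ ⟨z, rfl⟩
  rw [hA]
  exact hex.choose_spec.1 z

end LinearVersions

/-! ### Strong integrals of operators. -/

section StrongIntegral

variable {X : Type u} [NormedAddCommGroup X] [InnerProductSpace ℝ X] [CompleteSpace X]

/-- In a separable Hilbert space, weakly measurable functions are strongly measurable. -/
theorem aestronglyMeasurable_of_forall_inner [TopologicalSpace.SeparableSpace X] {α : Type*}
    [MeasurableSpace α] {ρ : Measure α} {f : α → X}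
    (h : ∀ y, AEStronglyMeasurable (fun r => ⟪y, f r⟫) ρ) : AEStronglyMeasurable f ρ := by
  have : Countable (basisSet X) := (basis X).orthonormal.countable
  refine aestronglyMeasurable_of_tendsto_ae (u := (atTop : Filter (Finset (basisSet X))))
    (f := fun J r => ∑ i ∈ J, ⟪basis X i, f r⟫ • basis X i) (fun J => ?_)
    (.of_forall fun r => ?_)
  · exact Finset.aestronglyMeasurable_fun_sum J fun i _ => (h _).smul_const _
  · have := (basis X).hasSum_repr (f r)
    simpa only [HilbertBasis.repr_apply_apply, HasSum, SummationFilter.unconditional_filter]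
      using this

theorem exists_isStrongIntegral {ρ : Measure ℝ} {A : ℝ → X →L[ℝ] X}
    (hA : ∀ x, AEStronglyMeasurable (fun r => A r x) ρ) {g : ℝ → ℝ} (hg : Integrable g ρ)
    (hAg : ∀ᵐ r ∂ρ, ∀ x, ‖A r x‖ ≤ g r * ‖x‖) : ∃ S, IsStrongIntegral ρ A S := by
  have hint : ∀ x, Integrable (fun r => A r x) ρ := fun x =>
    (hg.mul_const ‖x‖).mono' (hA x) (hAg.mono fun r hr => hr x)
  let S : X →ₗ[ℝ] X :=
    { toFun := fun x => ∫ r, A r x ∂ρ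
      map_add' := fun x y => by
        simp only [map_add]
        exact integral_add (hint x) (hint y)
      map_smul' := fun c x => by
        simp only [map_smul, RingHom.id_apply]
        exact integral_smul _ _ }
  refine ⟨S.mkContinuous (∫ r, g r ∂ρ) fun x => ?_, fun x => ⟨hint x, rfl⟩⟩
  rw [← integral_mul_const]
  exact norm_integral_le_of_norm_le (hg.mul_const ‖x‖) (hAg.mono fun r hr => hr x)

theorem isStrongIntegral_strongIntegral {ρ : Measure ℝ} {A : ℝ → X →L[ℝ] X}
    (h : ∃ S, IsStrongIntegral ρ A S) : IsStrongIntegral ρ A (strongIntegral ρ A) := by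
  rw [strongIntegral, dif_pos h]
  exact h.choose_spec

variable {ρ : Measure ℝ} {A : ℝ → X →L[ℝ] X} {S : X →L[ℝ] X}

theorem IsStrongIntegral.inner_apply (h : IsStrongIntegral ρ A S) (x y : X) :
    ⟪S x, y⟫ = ∫ r, ⟪A r x, y⟫ ∂ρ := by
  rw [(h x).2, real_inner_comm, ← integral_inner (h x).1]
  simp only [real_inner_comm]

theorem IsStrongIntegral.integrable_inner (h : IsStrongIntegral ρ A S) (x y : X) :
    Integrable (fun r => ⟪A r x, y⟫) ρ := (h x).1.inner_const y

theorem IsStrongIntegral.isPositive (h : IsStrongIntegral ρ A S) (hA : ∀ r, (A r).IsPositive) :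
    S.IsPositive := by
  refine ⟨fun x y => ?_, fun x => ?_⟩
  · change ⟪S x, y⟫ = ⟪x, S y⟫
    rw [h.inner_apply, real_inner_comm, h.inner_apply]
    refine integral_congr_ae (.of_forall fun r => ?_)
    change ⟪A r x, y⟫ = ⟪A r y, x⟫
    rw [(hA r).inner_left_eq_inner_right, real_inner_comm]
  · change 0 ≤ ⟪S x, x⟫
    rw [h.inner_apply]
    exact integral_nonneg fun r => (hA r).inner_nonneg_left x

theorem IsStrongIntegral.posTrace_eq [TopologicalSpace.SeparableSpace X]
    (h : IsStrongIntegral ρ A S) (hA : ∀ r, (A r).IsPositive) :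
    posTrace S = ∫⁻ r, posTrace (A r) ∂ρ := by
  have : Countable (basisSet X) := (basis X).orthonormal.countable
  unfold posTrace
  rw [lintegral_tsum fun i => (h.integrable_inner _ _).aemeasurable.ennreal_ofReal]
  refine tsum_congr fun i => ?_
  rw [h.inner_apply, ofReal_integral_eq_lintegral_ofReal (h.integrable_inner _ _)
    (.of_forall fun r => (hA r).inner_nonneg_left _)]

/-- Each factor of `Q = i i⋆` has squared Hilbert–Schmidt norm equal to the trace. The bound
supplies the dominating function for integrals over a half-line. -/
theorem enorm_apply_le_posTrace_mul {Q : X →L[ℝ] X} (hQ : Q.IsPositive) (x : X) :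
    ‖Q x‖ₑ ≤ posTrace Q * ‖x‖ₑ := by
  obtain ⟨w, e, -⟩ := exists_hilbertBasis ℝ (CameronMartin Q)
  have h1 := enorm_apply_sq_le (basis X) (cmInclL Q).adjoint x
  have h2 := enorm_apply_sq_le e (cmInclL Q) ((cmInclL Q).adjoint x)
  rw [← posTrace_eq_tsum hQ] at h1
  rw [tsum_enorm_cmInclL_sq hQ, cmInclL_adjoint_apply hQ] at h2
  have h3 : ‖Q x‖ₑ ^ 2 ≤ (posTrace Q * ‖x‖ₑ) ^ 2 := by
    calc ‖Q x‖ₑ ^ 2 ≤ posTrace Q * ‖(cmInclL Q).adjoint x‖ₑ ^ 2 := h2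
      _ ≤ posTrace Q * (posTrace Q * ‖x‖ₑ ^ 2) := by gcongr
      _ = _ := by ring
  exact (ENNReal.pow_le_pow_left_iff two_ne_zero).1 h3

theorem posTrace_zero : posTrace (0 : X →L[ℝ] X) = 0 := by
  simp [posTrace]

end StrongIntegral

/-! ### The covariance operators `Q(t, s)` and `Q(t, -∞)`. -/

section Covariance

variable {X : Type u} [NormedAddCommGroup X] [InnerProductSpace ℝ X] [CompleteSpace X]
  {U : ℝ → ℝ → X →L[ℝ] X} {B : ℝ → X →L[ℝ] X}

theorem inner_covIntegrand (U : ℝ → ℝ → X →L[ℝ] X) (B : ℝ → X →L[ℝ] X) (t r : ℝ) (x y : X) :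
    ⟪covIntegrand U B t r x, y⟫ =
      ⟪(B r).adjoint ((U t r).adjoint x), (B r).adjoint ((U t r).adjoint y)⟫ := by
  change ⟪U t r (B r ((B r).adjoint ((U t r).adjoint x))), y⟫ = _
  rw [← ContinuousLinearMap.adjoint_inner_right, ← ContinuousLinearMap.adjoint_inner_right]

theorem covIntegrand_isPositive (U : ℝ → ℝ → X →L[ℝ] X) (B : ℝ → X →L[ℝ] X) (t r : ℝ) :
    (covIntegrand U B t r).IsPositive := by
  refine ⟨fun x y => ?_, fun x => ?_⟩
  · change ⟪covIntegrand U B t r x, y⟫ = ⟪x, covIntegrand U B t r y⟫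
    rw [real_inner_comm _ x, inner_covIntegrand, inner_covIntegrand, real_inner_comm]
  · change 0 ≤ ⟪covIntegrand U B t r x, x⟫
    rw [inner_covIntegrand]
    exact real_inner_self_nonneg

/-- Banach–Steinhaus: each orbit `r ↦ U(t, r) x` is bounded near `-∞` because it tends to `0`, and
on the remaining compact interval by continuity. -/
theorem OUHypothesis.exists_norm_le (hyp : OUHypothesis U B) (t : ℝ) :
    ∃ M : ℝ, 0 ≤ M ∧ ∀ r ≤ t, ‖U t r‖ ≤ M := by
  have hcont : ∀ x, ContinuousOn (fun r => U t r x) (Iic t) := fun x =>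
    (hyp.continuous_evolution x).comp (f := fun r : ℝ => (r, t)) (by fun_prop) fun r hr => hr
  obtain ⟨C, hC⟩ := banach_steinhaus (g := fun r : Iic t => U t r) fun x => by
    obtain ⟨a, ha⟩ := ((hyp.evolution_tendsto t x).norm.eventually_le_const
      (by simp : ‖(0 : X)‖ < 1)).exists_forall_of_atBot
    obtain ⟨D, hD⟩ := (isCompact_Icc (a := a) (b := t)).exists_bound_of_continuousOn
      ((hcont x).mono Icc_subset_Iic_self)
    refine ⟨max 1 D, fun r => ?_⟩
    rcases le_total (r : ℝ) a with h | h
    · exact (ha _ h).trans (le_max_left _ _)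
    · exact (hD _ ⟨h, r.2⟩).trans (le_max_right _ _)
  exact ⟨max C 0, le_max_right _ _, fun r hr => (hC ⟨r, hr⟩).trans (le_max_left _ _)⟩

/-- Strong measurability does not pass directly to adjoints, but weak measurability does, and the
two coincide in a separable space. -/
theorem OUHypothesis.aestronglyMeasurable_covIntegrand [TopologicalSpace.SeparableSpace X]
    (hyp : OUHypothesis U B) (t : ℝ) (x : X) :
    AEStronglyMeasurable (fun r => covIntegrand U B t r x) (volume.restrict (Iic t)) := by
  have hcont : ∀ x, ContinuousOn (fun r => U t r x) (Iic t) := fun x =>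
    (hyp.continuous_evolution x).comp (f := fun r : ℝ => (r, t)) (by fun_prop) fun r hr => hr
  have hU : ∀ x, AEStronglyMeasurable (fun r => (U t r).adjoint x) (volume.restrict (Iic t)) :=
    fun x => aestronglyMeasurable_of_forall_inner fun y => by
      simp_rw [ContinuousLinearMap.adjoint_inner_right]
      exact ((hcont y).inner continuousOn_const).aestronglyMeasurable measurableSet_Iic
  have hBU : ∀ x, AEStronglyMeasurable (fun r => (B r).adjoint ((U t r).adjoint x))
      (volume.restrict (Iic t)) :=
    fun x => aestronglyMeasurable_of_forall_inner fun y => by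
      refine (AEStronglyMeasurable.inner (𝕜 := ℝ) (hyp.measurable y).restrict (hU x)).congr
        (.of_forall fun r => ?_)
      exact (ContinuousLinearMap.adjoint_inner_right _ _ _).symm
  refine aestronglyMeasurable_of_forall_inner fun y => ?_
  simp_rw [real_inner_comm _ y, inner_covIntegrand]
  exact (hBU x).inner (hBU y)

theorem OUHypothesis.isStrongIntegral_covOp [TopologicalSpace.SeparableSpace X]
    (hyp : OUHypothesis U B) (s t : ℝ) :
    IsStrongIntegral (volume.restrict (Ioc s t)) (covIntegrand U B t) (covOp U B t s) := by
  obtain ⟨M, hM0, hM⟩ := hyp.exists_norm_le t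
  obtain ⟨K, hK0, hK⟩ := hyp.bounded
  refine isStrongIntegral_strongIntegral (exists_isStrongIntegral (fun x =>
    (hyp.aestronglyMeasurable_covIntegrand t x).mono_measure
      (Measure.restrict_mono Ioc_subset_Iic_self le_rfl))
    (integrable_const (M * (K * (K * M)))) ?_)
  filter_upwards [ae_restrict_mem measurableSet_Ioc] with r hr x
  have hU := hM r hr.2
  refine ContinuousLinearMap.le_of_opNorm_le _ ?_ x
  refine (ContinuousLinearMap.opNorm_comp_le _ _).trans (mul_le_mul hU ?_ (norm_nonneg _) hM0)
  refine (ContinuousLinearMap.opNorm_comp_le _ _).trans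
    (mul_le_mul (hK r) ?_ (norm_nonneg _) hK0.le)
  refine (ContinuousLinearMap.opNorm_comp_le _ _).trans (mul_le_mul ?_ ?_ (norm_nonneg _) hK0.le)
  · rw [LinearIsometryEquiv.norm_map]
    exact hK r
  · rw [LinearIsometryEquiv.norm_map]
    exact hU

theorem OUHypothesis.covOp_isPositive [TopologicalSpace.SeparableSpace X]
    (hyp : OUHypothesis U B) (s t : ℝ) : (covOp U B t s).IsPositive :=
  (hyp.isStrongIntegral_covOp s t).isPositive (covIntegrand_isPositive U B t)

theorem OUHypothesis.covOp_self [TopologicalSpace.SeparableSpace X]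
    (hyp : OUHypothesis U B) (t : ℝ) : covOp U B t t = 0 := by
  ext x
  rw [(hyp.isStrongIntegral_covOp t t x).2]
  simp

theorem OUHypothesis.posTrace_covOp_ne_top [TopologicalSpace.SeparableSpace X]
    (hyp : OUHypothesis U B) {s t : ℝ} (hst : s ≤ t) : posTrace (covOp U B t s) ≠ ∞ := by
  rcases hst.eq_or_lt with rfl | h
  · rw [hyp.covOp_self, posTrace_zero]
    exact ENNReal.zero_ne_top
  · exact (hyp.finite_trace s t h).ne

theorem OUHypothesis.aemeasurable_posTrace_covIntegrand [TopologicalSpace.SeparableSpace X]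
    (hyp : OUHypothesis U B) (t : ℝ) :
    AEMeasurable (fun r => posTrace (covIntegrand U B t r)) (volume.restrict (Iic t)) := by
  have : Countable (basisSet X) := (basis X).orthonormal.countable
  exact AEMeasurable.tsum fun i => ((hyp.aestronglyMeasurable_covIntegrand t
    _).inner_const).aemeasurable.ennreal_ofReal

/-- On each bounded interval the integrated trace is the trace of some `Q(t, s)`, which is bounded
uniformly in `s`; the intervals exhaust the half-line. -/
theorem OUHypothesis.lintegral_posTrace_ne_top [TopologicalSpace.SeparableSpace X]
    (hyp : OUHypothesis U B) (t : ℝ) :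
    ∫⁻ r in Iic t, posTrace (covIntegrand U B t r) ≠ ∞ := by
  -- The shift `n + 1` keeps the left endpoint strictly below `t`, where the supremum hypothesis
  -- applies.
  have hcover : AECover (volume.restrict (Iic t)) atTop fun n : ℕ => Ioc (t - (n + 1)) t := by
    refine ⟨?_, fun _ => measurableSet_Ioc⟩
    filter_upwards [ae_restrict_mem measurableSet_Iic] with r hr
    obtain ⟨N, hN⟩ := exists_nat_gt (t - r)
    filter_upwards [eventually_ge_atTop N] with n hn
    have : (N : ℝ) ≤ n := by exact_mod_cast hn
    exact ⟨by linarith, hr⟩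
  have hlim := hcover.lintegral_tendsto_of_nat (hyp.aemeasurable_posTrace_covIntegrand t)
  refine ((le_of_tendsto' hlim fun n => ?_).trans_lt (hyp.sup_trace t)).ne
  rw [Measure.restrict_restrict measurableSet_Ioc, inter_eq_left.2 Ioc_subset_Iic_self,
    ← (hyp.isStrongIntegral_covOp _ t).posTrace_eq (covIntegrand_isPositive U B t)]
  have hn : t - ((n : ℝ) + 1) ∈ Iio t := by
    have : (0 : ℝ) ≤ n := n.cast_nonneg
    rw [mem_Iio]
    linarith
  exact le_iSup₂ (f := fun s (_ : s ∈ Iio t) => posTrace (covOp U B t s)) _ hn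

theorem OUHypothesis.isStrongIntegral_covOpInf [TopologicalSpace.SeparableSpace X]
    (hyp : OUHypothesis U B) (t : ℝ) :
    IsStrongIntegral (volume.restrict (Iic t)) (covIntegrand U B t) (covOpInf U B t) := by
  refine isStrongIntegral_strongIntegral (exists_isStrongIntegral
    (hyp.aestronglyMeasurable_covIntegrand t) (integrable_toReal_of_lintegral_ne_top
      (hyp.aemeasurable_posTrace_covIntegrand t) (hyp.lintegral_posTrace_ne_top t)) ?_)
  filter_upwards [ae_lt_top' (hyp.aemeasurable_posTrace_covIntegrand t)
    (hyp.lintegral_posTrace_ne_top t)] with r hr x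
  have h := ENNReal.toReal_mono (ENNReal.mul_ne_top hr.ne (by simp))
    (enorm_apply_le_posTrace_mul (covIntegrand_isPositive U B t r) x)
  simpa only [ENNReal.toReal_mul, toReal_enorm] using h

theorem OUHypothesis.covOpInf_isPositive [TopologicalSpace.SeparableSpace X]
    (hyp : OUHypothesis U B) (t : ℝ) : (covOpInf U B t).IsPositive :=
  (hyp.isStrongIntegral_covOpInf t).isPositive (covIntegrand_isPositive U B t)

theorem OUHypothesis.posTrace_covOpInf_ne_top [TopologicalSpace.SeparableSpace X]
    (hyp : OUHypothesis U B) (t : ℝ) : posTrace (covOpInf U B t) ≠ ∞ := by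
  rw [(hyp.isStrongIntegral_covOpInf t).posTrace_eq (covIntegrand_isPositive U B t)]
  exact hyp.lintegral_posTrace_ne_top t

/-- `Q(t, -∞) = U(t, s) Q(s, -∞) U(t, s)⋆ + Q(t, s)`. -/
theorem OUHypothesis.covOpInf_apply [TopologicalSpace.SeparableSpace X]
    (hyp : OUHypothesis U B) {s t : ℝ} (hst : s ≤ t) (x : X) :
    covOpInf U B t x = U t s (covOpInf U B s ((U t s).adjoint x)) + covOp U B t s x := by
  have hint := (hyp.isStrongIntegral_covOpInf t x).1
  rw [(hyp.isStrongIntegral_covOpInf t x).2, (hyp.isStrongIntegral_covOp s t x).2,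
    (hyp.isStrongIntegral_covOpInf s _).2, ← Iic_union_Ioc_eq_Iic hst,
    setIntegral_union (Iic_disjoint_Ioc le_rfl) measurableSet_Ioc
      (hint.mono_measure (Measure.restrict_mono (Iic_subset_Iic.2 hst) le_rfl))
      (hint.mono_measure (Measure.restrict_mono Ioc_subset_Iic_self le_rfl)),
    ← ContinuousLinearMap.integral_comp_comm _ (hyp.isStrongIntegral_covOpInf s _).1]
  congr 1
  -- For `r ≤ s`, factor `U(t, r) = U(t, s) U(s, r)` on both sides of the integrand.
  refine setIntegral_congr_fun measurableSet_Iic fun r hr => ?_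
  have h := hyp.evolution_comp r s t hr hst
  simp only [covIntegrand, ← h, ContinuousLinearMap.comp_apply, ContinuousLinearMap.adjoint_comp]

theorem OUHypothesis.inner_covOpInf [TopologicalSpace.SeparableSpace X]
    (hyp : OUHypothesis U B) {s t : ℝ} (hst : s ≤ t) (x : X) :
    ⟪covOpInf U B t x, x⟫ = ⟪covOpInf U B s ((U t s).adjoint x), (U t s).adjoint x⟫ +
      ⟪covOp U B t s x, x⟫ := by
  rw [hyp.covOpInf_apply hst, inner_add_left, ContinuousLinearMap.adjoint_inner_right]

end Covariance

/-! ### Mehler's formula, measure preservation and extension to `L^p`. -/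

section Mehler

variable {X : Type u} [NormedAddCommGroup X] [InnerProductSpace ℝ X] [CompleteSpace X]
  [MeasurableSpace X] [BorelSpace X] [SecondCountableTopology X]

section Defect

variable {Qs Qt R A : X →L[ℝ] X} {V : CameronMartin Qs →L[ℝ] CameronMartin Qt}

theorem norm_adjoint_cmInclL_le (hs : Qs.IsPositive) (ht : Qt.IsPositive) (hR : R.IsPositive)
    (hdec : ∀ x, ⟪Qt x, x⟫ = ⟪Qs (A.adjoint x), A.adjoint x⟫ + ⟪R x, x⟫) (x : X) :
    ‖(cmInclL Qs).adjoint (A.adjoint x)‖ ≤ ‖(cmInclL Qt).adjoint x‖ := by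
  refine le_of_sq_le_sq ?_ (norm_nonneg _)
  rw [norm_cmInclL_adjoint_sq hs, norm_cmInclL_adjoint_sq ht, hdec]
  linarith [hR.inner_nonneg_left x]

theorem adjoint_restriction_apply (hV : ∀ z, cmIncl Qt (V z) = A (cmIncl Qs z)) (x : X) :
    V.adjoint ((cmInclL Qt).adjoint x) = (cmInclL Qs).adjoint (A.adjoint x) := by
  have h : cmInclL Qt ∘L V = A ∘L cmInclL Qs := ContinuousLinearMap.ext hV
  have h2 := congrArg ContinuousLinearMap.adjoint h
  rw [ContinuousLinearMap.adjoint_comp, ContinuousLinearMap.adjoint_comp] at h2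
  exact DFunLike.congr_fun h2 x

theorem id_sub_adjoint_comp_isPositive {Qμ Qν : X →L[ℝ] X}
    {T : CameronMartin Qμ →L[ℝ] CameronMartin Qν} (hT : ‖T‖ ≤ 1) :
    (ContinuousLinearMap.id ℝ (CameronMartin Qμ) - T.adjoint ∘L T).IsPositive := by
  refine ⟨fun x y => ?_, fun x => ?_⟩
  · simp only [ContinuousLinearMap.coe_coe, sub_apply, ContinuousLinearMap.comp_apply,
      inner_sub_left, inner_sub_right, ContinuousLinearMap.adjoint_inner_left,
      ContinuousLinearMap.adjoint_inner_right, ContinuousLinearMap.id_apply]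
  · change 0 ≤ ⟪x - T.adjoint (T x), x⟫
    rw [inner_sub_left, ContinuousLinearMap.adjoint_inner_left, real_inner_self_eq_norm_sq,
      real_inner_self_eq_norm_sq, sub_nonneg]
    have : ‖T x‖ ≤ ‖x‖ := by simpa using T.le_of_opNorm_le hT x
    gcongr

/-- Squaring the defect on `y = i_t⋆ x` gives `‖y‖² - ‖V⋆ y‖²`. Since `V⋆ i_t⋆ = i_s⋆ A⋆`, this is
`⟪Qt x, x⟫ - ⟪Qs A⋆ x, A⋆ x⟫`, which `hdec` identifies. -/
theorem norm_defect_adjoint_sq (hs : Qs.IsPositive) (ht : Qt.IsPositive)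
    (hdec : ∀ x, ⟪Qt x, x⟫ = ⟪Qs (A.adjoint x), A.adjoint x⟫ + ⟪R x, x⟫)
    (hV : ∀ z, cmIncl Qt (V z) = A (cmIncl Qs z)) (hV1 : ‖V‖ ≤ 1) (x : X) :
    ⟪R x, x⟫ = ‖(defect V.adjoint).adjoint ((cmInclL Qt).adjoint x)‖ ^ 2 := by
  have hpos : (ContinuousLinearMap.id ℝ (CameronMartin Qt) -
      V.adjoint.adjoint ∘L V.adjoint).IsPositive :=
    id_sub_adjoint_comp_isPositive (by rwa [LinearIsometryEquiv.norm_map])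
  have hD : (defect V.adjoint).IsPositive := posSqrt_isPositive hpos
  set y := (cmInclL Qt).adjoint x with hy
  rw [hD.isSelfAdjoint.adjoint_eq, ← real_inner_self_eq_norm_sq, ← hD.inner_left_eq_inner_right,
    defect, posSqrt_posSqrt_apply hpos, sub_apply, ContinuousLinearMap.id_apply,
    ContinuousLinearMap.comp_apply, inner_sub_left,
    ContinuousLinearMap.adjoint_inner_left V.adjoint,
    real_inner_self_eq_norm_sq, real_inner_self_eq_norm_sq, hy, adjoint_restriction_apply hV,
    norm_cmInclL_adjoint_sq hs, norm_cmInclL_adjoint_sq ht, hdec]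
  ring

/-- Mehler's formula for the second quantization of the adjoint of a restriction. -/
theorem quantizationIntegral_eq (hs : Qs.IsPositive) (ht : Qt.IsPositive)
    (htr : posTrace Qt ≠ ∞) (hR : R.IsPositive)
    (hdec : ∀ x, ⟪Qt x, x⟫ = ⟪Qs (A.adjoint x), A.adjoint x⟫ + ⟪R x, x⟫)
    (hV : ∀ z, cmIncl Qt (V z) = A (cmIncl Qs z)) (hV1 : ‖V‖ ≤ 1) {F G : X →ₗ[ℝ] X}
    (hG : IsLinearVersion (defect V.adjoint) G) {f : X → ℝ} (hf : Measurable f) (x : X) :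
    quantizationIntegral (gaussianMeasure 0 Qt) F G f x =
      ∫ y, f (F x + y) ∂(gaussianMeasure 0 R) := by
  have hlaw := hG.isGaussianWith_map ht htr hR (norm_defect_adjoint_sq hs ht hdec hV hV1)
  have hm : Measurable fun y => f (F x + y) := hf.comp (measurable_const_add (F x))
  rw [hlaw.gaussianMeasure_eq, integral_map hG.1 hm.aestronglyMeasurable]
  rfl

end Defect

section MeasurePreserving

variable {μ ν N : Measure X} {Qs Qt R A : X →L[ℝ] X}

/-- The image measure is the convolution of `ν.map A` with `N`, so characteristic functions multiply
and the covariances add up as in `hdec`. -/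
theorem measurePreserving_apply_add (hν : IsGaussianWith ν 0 Qs) (hN : IsGaussianWith N 0 R)
    (hμ : IsGaussianWith μ 0 Qt)
    (hdec : ∀ x, ⟪Qt x, x⟫ = ⟪Qs (A.adjoint x), A.adjoint x⟫ + ⟪R x, x⟫) :
    MeasurePreserving (fun p : X × X => A p.1 + p.2) (ν.prod N) μ := by
  have := hν.1
  have := hN.1
  have := hμ.1
  have hm : Measurable fun p : X × X => A p.1 + p.2 := by fun_prop
  refine ⟨hm, ?_⟩
  have := Measure.isProbabilityMeasure_map (μ := ν.prod N) hm.aemeasurable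
  have hconv : (ν.prod N).map (fun p : X × X => A p.1 + p.2) = (ν.map A) ∗ N := by
    have h := Measure.map_prod_map ν N (f := A) (g := id) (by fun_prop) measurable_id
    rw [Measure.map_id] at h
    rw [Measure.conv, h, Measure.map_map (by fun_prop) (by fun_prop)]
    rfl
  refine Measure.ext_of_charFun (funext fun t => ?_)
  have := Measure.isProbabilityMeasure_map (μ := ν) (f := A) (by fun_prop)
  have hA : charFun (ν.map A) t = charFun ν (A.adjoint t) := by
    rw [charFun_apply, charFun_apply, integral_map (by fun_prop) (by fun_prop)]
    simp only [ContinuousLinearMap.adjoint_inner_right]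
  rw [hconv, charFun_conv, hA, hν.charFun_eq, hN.charFun_eq, hμ.charFun_eq, ← Complex.exp_add,
    hdec]
  congr 1
  push_cast
  simp only [inner_zero_right, Complex.ofReal_zero]
  ring

end MeasurePreserving

section LpExtension

variable {μ ν N : Measure X} [IsProbabilityMeasure μ] [IsProbabilityMeasure ν]
  [IsProbabilityMeasure N] {A : X →L[ℝ] X} {p : ℝ≥0∞} {f g : X → ℝ}

theorem ae_integral_congr
    (hφ : MeasurePreserving (fun q : X × X => A q.1 + q.2) (ν.prod N) μ) (h : f =ᵐ[μ] g) :
    ∀ᵐ x ∂ν, ∫ y, f (A x + y) ∂N = ∫ y, g (A x + y) ∂N := by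
  have h1 := hφ.quasiMeasurePreserving.ae_eq_comp h
  filter_upwards [Measure.ae_ae_of_ae_prod h1] with x hx
  exact integral_congr_ae hx

/-- Jensen in the inner variable, in the form of the inclusion of `L^p` in `L^1` for the probability
measure `N`, then Tonelli and the measure-preserving map. -/
theorem memLp_integral (hφ : MeasurePreserving (fun q : X × X => A q.1 + q.2) (ν.prod N) μ)
    (hp : 1 ≤ p) (hp' : p ≠ ∞) (hf : MemLp f p μ) :
    MemLp (fun x => ∫ y, f (A x + y) ∂N) p ν ∧
      eLpNorm (fun x => ∫ y, f (A x + y) ∂N) p ν ≤ eLpNorm f p μ := by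
  have hp0 : p ≠ 0 := (zero_lt_one.trans_le hp).ne'
  have hpr : 0 < p.toReal := ENNReal.toReal_pos hp0 hp'
  have h1 : AEStronglyMeasurable (fun q : X × X => f (A q.1 + q.2)) (ν.prod N) :=
    hf.1.comp_measurePreserving hφ
  have hm : AEStronglyMeasurable (fun x => ∫ y, f (A x + y) ∂N) ν := h1.integral_prod_right'
  have hle : eLpNorm (fun x => ∫ y, f (A x + y) ∂N) p ν ≤ eLpNorm f p μ := by
    rw [← eLpNorm_comp_measurePreserving hf.1 hφ, eLpNorm_eq_lintegral_rpow_enorm_toReal hp0 hp',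
      eLpNorm_eq_lintegral_rpow_enorm_toReal hp0 hp']
    refine ENNReal.rpow_le_rpow ?_ (by positivity)
    simp only [Function.comp_def]
    rw [lintegral_prod _ (h1.enorm.pow_const _)]
    refine lintegral_mono_ae ?_
    filter_upwards [h1.prodMk_left] with x hx
    calc ‖∫ y, f (A x + y) ∂N‖ₑ ^ p.toReal
        ≤ (eLpNorm (fun y => f (A x + y)) 1 N) ^ p.toReal := by
          rw [eLpNorm_one_eq_lintegral_enorm]
          gcongr
          exact enorm_integral_le_lintegral_enorm _
      _ ≤ (eLpNorm (fun y => f (A x + y)) p N) ^ p.toReal := by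
          gcongr
          exact eLpNorm_le_eLpNorm_of_exponent_le hp hx
      _ = ∫⁻ y, ‖f (A x + y)‖ₑ ^ p.toReal ∂N := by
          rw [eLpNorm_eq_lintegral_rpow_enorm_toReal hp0 hp', ← ENNReal.rpow_mul,
            one_div_mul_cancel hpr.ne', ENNReal.rpow_one]
  exact ⟨⟨hm, hle.trans_lt hf.2⟩, hle⟩

theorem ae_integrable (hφ : MeasurePreserving (fun q : X × X => A q.1 + q.2) (ν.prod N) μ)
    (hp : 1 ≤ p) (hf : MemLp f p μ) : ∀ᵐ x ∂ν, Integrable (fun y => f (A x + y)) N := by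
  have h1 : Integrable (fun q : X × X => f (A q.1 + q.2)) (ν.prod N) :=
    (hf.comp_measurePreserving hφ).integrable hp
  exact h1.prod_right_ae

/-- The operator `f ↦ (x ↦ ∫ f (A x + y) N(dy))` is a contraction between `L^p` spaces. -/
theorem exists_lp_extension
    (hφ : MeasurePreserving (fun q : X × X => A q.1 + q.2) (ν.prod N) μ) [Fact (1 ≤ p)]
    (hp' : p ≠ ∞) : ∃ S : Lp ℝ p μ →L[ℝ] Lp ℝ p ν, ∀ f : X → ℝ, ∀ hf : MemLp f p μ,
      S (hf.toLp f) =ᵐ[ν] fun x => ∫ y, f (A x + y) ∂N := by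
  have hp : 1 ≤ p := Fact.out
  have hmem := fun u : Lp ℝ p μ => memLp_integral hφ hp hp' (Lp.memLp u)
  let S : Lp ℝ p μ →ₗ[ℝ] Lp ℝ p ν :=
    { toFun := fun u => (hmem u).1.toLp _
      map_add' := fun u v => by
        rw [← MemLp.toLp_add, MemLp.toLp_eq_toLp_iff]
        filter_upwards [ae_integral_congr hφ (Lp.coeFn_add u v),
          ae_integrable hφ hp (Lp.memLp u), ae_integrable hφ hp (Lp.memLp v)] with x hx hu hv
        rw [hx]
        exact integral_add hu hv
      map_smul' := fun c u => by
        rw [RingHom.id_apply, ← MemLp.toLp_const_smul, MemLp.toLp_eq_toLp_iff]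
        filter_upwards [ae_integral_congr hφ (Lp.coeFn_smul c u)] with x hx
        rw [hx]
        exact integral_smul c fun y => u (A x + y) }
  refine ⟨S.mkContinuous 1 fun u => ?_, fun f hf => ?_⟩
  · rw [one_mul]
    change ‖(hmem u).1.toLp _‖ ≤ ‖u‖
    rw [Lp.norm_toLp, Lp.norm_def]
    exact ENNReal.toReal_mono (Lp.eLpNorm_ne_top u) (hmem u).2
  · refine (MemLp.coeFn_toLp (hmem (hf.toLp f)).1).trans ?_
    exact ae_integral_congr hφ hf.coeFn_toLp

/-- Simple functions are bounded Borel, hence in `D`, and are dense in `L^p` for finite `p`. -/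
theorem IsLpExtension.eq [Fact (1 ≤ p)] (hp' : p ≠ ∞) {D : Set (X → ℝ)} (hD : boundedBorel X ⊆ D)
    {P : (X → ℝ) → X → ℝ} {S S' : Lp ℝ p μ →L[ℝ] Lp ℝ p ν} (hS : IsLpExtension D P p μ ν S)
    (hS' : IsLpExtension D P p μ ν S') : S' = S := by
  refine ContinuousLinearMap.ext fun u => ?_
  refine congrFun ((Lp.simpleFunc.denseRange hp').equalizer S'.continuous S.continuous ?_) u
  funext v
  set σ := Lp.simpleFunc.toSimpleFunc v with hσ
  have hmem : MemLp σ p μ := Lp.simpleFunc.memLp v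
  have hv : (v : Lp ℝ p μ) = hmem.toLp σ := by
    rw [← congrArg Subtype.val (Lp.simpleFunc.toLp_toSimpleFunc v)]
  have hb : (σ : X → ℝ) ∈ D := by
    obtain ⟨M, hM⟩ := σ.exists_forall_norm_le
    exact hD ⟨σ.measurable, M, hM⟩
  simp only [Function.comp_apply]
  rw [hv]
  exact Lp.ext ((hS' σ hb hmem).trans (hS σ hb hmem).symm)

theorem boundedBorel_subset_expGrowth : boundedBorel X ⊆ expGrowth X := by
  rintro f ⟨hf, M, hM⟩
  refine ⟨hf, max M 1, 1, by positivity, one_pos, fun x => (hM x).trans ?_⟩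
  refine (le_max_left M 1).trans (le_mul_of_one_le_right (by positivity) ?_)
  exact Real.one_le_exp (by positivity)

end LpExtension

section Evolution

variable {U : ℝ → ℝ → X →L[ℝ] X} {B : ℝ → X →L[ℝ] X}

theorem OUHypothesis.isGaussianWith_covOp (hyp : OUHypothesis U B) {s t : ℝ} (hst : s ≤ t) (a : X) :
    IsGaussianWith (gaussianMeasure a (covOp U B t s)) a (covOp U B t s) :=
  isGaussianWith_gaussianMeasure (hyp.covOp_isPositive s t) (hyp.posTrace_covOp_ne_top hst) a

theorem OUHypothesis.isGaussianWith_gammaMeasure (hyp : OUHypothesis U B) (t : ℝ) :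
    IsGaussianWith (gammaMeasure U B t) 0 (covOpInf U B t) :=
  isGaussianWith_gaussianMeasure (hyp.covOpInf_isPositive t) (hyp.posTrace_covOpInf_ne_top t) 0

/-- Translating the Gaussian measure handles `s < t`. At `s = t` the covariance vanishes and `N(0,
0)` is the Dirac mass at `0`, so the same formula covers `P_{t,t} = I`. -/
theorem OUHypothesis.ouEvolution_eq (hyp : OUHypothesis U B) {s t : ℝ} (hst : s ≤ t)
    (f : X → ℝ) (x : X) :
    ouEvolution U B s t f x = ∫ y, f (U t s x + y) ∂(gaussianMeasure 0 (covOp U B t s)) := by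
  rcases hst.eq_or_lt with rfl | h
  · have hdirac : gaussianMeasure (0 : X) (covOp U B s s) = Measure.dirac 0 := by
      refine IsGaussianWith.gaussianMeasure_eq (isGaussianWith_of_charFun
        (hyp.covOp_isPositive s s) fun t => ?_)
      simp [hyp.covOp_self]
    rw [ouEvolution, if_neg (lt_irrefl _), hdirac, integral_dirac, hyp.evolution_self]
    simp
  · rw [ouEvolution, if_pos h, gaussianMeasure_eq_map (hyp.covOp_isPositive s t)
      (hyp.posTrace_covOp_ne_top hst), (measurableEmbedding_addLeft _).integral_map]

theorem OUHypothesis.measurePreserving (hyp : OUHypothesis U B) {s t : ℝ} (hst : s ≤ t) :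
    MeasurePreserving (fun q : X × X => U t s q.1 + q.2)
      ((gammaMeasure U B s).prod (gaussianMeasure 0 (covOp U B t s))) (gammaMeasure U B t) :=
  measurePreserving_apply_add (hyp.isGaussianWith_gammaMeasure s) (hyp.isGaussianWith_covOp hst 0)
    (hyp.isGaussianWith_gammaMeasure t) (hyp.inner_covOpInf hst)

theorem OUHypothesis.isEvolutionSystem (hyp : OUHypothesis U B) :
    IsEvolutionSystem (ouEvolution U B) (gammaMeasure U B) := by
  have hprob : ∀ t, IsProbabilityMeasure (gammaMeasure U B t) := fun t => by
    have := (hyp.isGaussianWith_gammaMeasure t).1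
    infer_instance
  refine ⟨hprob, fun s t hst φ => ?_⟩
  have := hprob s
  have := hprob t
  have := (hyp.isGaussianWith_covOp hst (0 : X)).1
  have hφ := hyp.measurePreserving hst
  have hm : AEStronglyMeasurable φ (gammaMeasure U B t) :=
    φ.continuous.measurable.aestronglyMeasurable
  have hint : Integrable φ (gammaMeasure U B t) := φ.integrable _
  rw [integral_congr_ae (.of_forall fun x => hyp.ouEvolution_eq hst φ x), ← hφ.map_eq,
    integral_map hφ.measurable.aemeasurable (by rwa [hφ.map_eq])]
  exact (integral_prod _ (hφ.integrable_comp_of_integrable hint)).symm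

end Evolution

end Mehler

end OUEvolution

end

/-! ### The main theorem. -/

open OUEvolution in
theorem mainTheorem1 {X : Type*} [NormedAddCommGroup X] [InnerProductSpace ℝ X] [CompleteSpace X]
    [TopologicalSpace.SeparableSpace X] [MeasurableSpace X] [BorelSpace X]
    (U : ℝ → ℝ → X →L[ℝ] X) (B : ℝ → X →L[ℝ] X) (hyp : OUHypothesis U B) :
    -- the objects are well defined
    ((∀ s t, s < t →
        IsStrongIntegral (volume.restrict (Ioc s t)) (covIntegrand U B t) (covOp U B t s) ∧
        ∀ x, IsGaussianWith (gaussianMeasure (U t s x) (covOp U B t s)) (U t s x) (covOp U B t s)) ∧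
      (∀ t, IsStrongIntegral (volume.restrict (Iic t)) (covIntegrand U B t) (covOpInf U B t) ∧
        IsGaussianWith (gammaMeasure U B t) 0 (covOpInf U B t)) ∧
      IsEvolutionSystem (ouEvolution U B) (gammaMeasure U B)) ∧
    ∀ s t, s ≤ t →
      -- `V` is the restriction of `U(t, s)` to `H_s`, and `L` is its adjoint
      ∃ (V : CameronMartin (covOpInf U B s) →L[ℝ] CameronMartin (covOpInf U B t))
        (L : CameronMartin (covOpInf U B t) →L[ℝ] CameronMartin (covOpInf U B s)),
        (∀ h, cmIncl (covOpInf U B t) (V h) = U t s (cmIncl (covOpInf U B s) h)) ∧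
        L = ContinuousLinearMap.adjoint V ∧ ‖L‖ ≤ 1 ∧
        -- the representation formula
        (∀ f ∈ boundedBorel X,
          ouEvolution U B s t f =ᵐ[gammaMeasure U B s] secondQuantization L f ∧
          ∀ x ∈ closure (range (cmIncl (covOpInf U B s))),
            ouEvolution U B s t f x = secondQuantization L f x) ∧
        -- it does not depend on the chosen versions, and holds everywhere for the version `U(t, s)`
        IsLinearVersion (ContinuousLinearMap.adjoint L) (U t s : X →ₗ[ℝ] X) ∧
        IsLinearVersion (ContinuousLinearMap.adjoint L)
          (infExt (ContinuousLinearMap.adjoint L)) ∧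
        IsLinearVersion (defect L) (infExt (defect L)) ∧
        (∀ F G : X →ₗ[ℝ] X, IsLinearVersion (ContinuousLinearMap.adjoint L) F →
          IsLinearVersion (defect L) G → ∀ f ∈ boundedBorel X,
            ouEvolution U B s t f =ᵐ[gammaMeasure U B s]
              quantizationIntegral (gammaMeasure U B t) F G f ∧
            ∀ x, F x = U t s x →
              ouEvolution U B s t f x = quantizationIntegral (gammaMeasure U B t) F G f x) ∧
        -- the extensions to `L^p` exist, are unique, and coincide
        ∀ (p : ℝ≥0∞) [Fact (1 ≤ p)], p ≠ ∞ →
          ∃ S : Lp ℝ p (gammaMeasure U B t) →L[ℝ] Lp ℝ p (gammaMeasure U B s),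
            (IsLpExtension (boundedBorel X) (ouEvolution U B s t) p
                (gammaMeasure U B t) (gammaMeasure U B s) S ∧
              ∀ S', IsLpExtension (boundedBorel X) (ouEvolution U B s t) p
                (gammaMeasure U B t) (gammaMeasure U B s) S' → S' = S) ∧
            (IsLpExtension (expGrowth X) (secondQuantization L) p
                (gammaMeasure U B t) (gammaMeasure U B s) S ∧
              ∀ S', IsLpExtension (expGrowth X) (secondQuantization L) p
                (gammaMeasure U B t) (gammaMeasure U B s) S' → S' = S) := by
  have : SecondCountableTopology X := UniformSpace.secondCountable_of_separable X
  refine ⟨⟨fun s t hst => ⟨hyp.isStrongIntegral_covOp s t,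
      fun x => hyp.isGaussianWith_covOp hst.le _⟩,
    fun t => ⟨hyp.isStrongIntegral_covOpInf t, hyp.isGaussianWith_gammaMeasure t⟩,
    hyp.isEvolutionSystem⟩, fun s t hst => ?_⟩
  have hs := hyp.covOpInf_isPositive s
  have ht := hyp.covOpInf_isPositive t
  have hR := hyp.covOp_isPositive s t
  have hts := hyp.posTrace_covOpInf_ne_top s
  have htt := hyp.posTrace_covOpInf_ne_top t
  have hdec := hyp.inner_covOpInf hst
  have hφ := hyp.measurePreserving hst
  have := (hyp.isGaussianWith_gammaMeasure s).1
  have := (hyp.isGaussianWith_gammaMeasure t).1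
  have := (hyp.isGaussianWith_covOp hst (0 : X)).1
  -- The contraction property of `L = V⋆` comes from here: discarding `Q(t, s) ≥ 0` in the splitting
  -- gives the domination required.
  obtain ⟨V, hV1, hV⟩ := exists_restriction (U t s) (norm_adjoint_cmInclL_le hs ht hR hdec)
  have hVU : ∀ z, U t s (cmIncl (covOpInf U B s) z) = cmIncl (covOpInf U B t) (V z) :=
    fun z => (hV z).symm
  have hadj : V.adjoint.adjoint = V := ContinuousLinearMap.adjoint_adjoint V
  have hinf : IsLinearVersion V (infExt V) := isLinearVersion_infExt hs hts ht htt V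
  have hdef : IsLinearVersion (defect V.adjoint) (infExt (defect V.adjoint)) :=
    isLinearVersion_infExt ht htt ht htt _
  have hMehler : ∀ F G : X →ₗ[ℝ] X, IsLinearVersion (defect V.adjoint) G →
      ∀ f : X → ℝ, Measurable f → ∀ x, quantizationIntegral (gammaMeasure U B t) F G f x =
        ∫ y, f (F x + y) ∂(gaussianMeasure 0 (covOp U B t s)) :=
    fun F G hG f hf x => quantizationIntegral_eq hs ht htt hR hdec hV hV1 hG hf x
  have hpoint : ∀ F G : X →ₗ[ℝ] X, IsLinearVersion (defect V.adjoint) G →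
      ∀ f : X → ℝ, Measurable f → ∀ x, F x = U t s x →
        ouEvolution U B s t f x = quantizationIntegral (gammaMeasure U B t) F G f x :=
    fun F G hG f hf x hx => by rw [hMehler F G hG f hf, hyp.ouEvolution_eq hst, hx]
  have hae : ∀ F G : X →ₗ[ℝ] X, IsLinearVersion V F → IsLinearVersion (defect V.adjoint) G →
      ∀ f : X → ℝ, Measurable f → ouEvolution U B s t f =ᵐ[gammaMeasure U B s]
        quantizationIntegral (gammaMeasure U B t) F G f := by
    intro F G hF hG f hf
    filter_upwards [hF.ae_eq hs hts ht htt hVU] with x hx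
    exact hpoint F G hG f hf x hx
  have hsq : ∀ f, secondQuantization V.adjoint f =
      quantizationIntegral (gammaMeasure U B t) (infExt V) (infExt (defect V.adjoint)) f := by
    intro f
    funext x
    rw [secondQuantization, hadj]
    rfl
  refine ⟨V, V.adjoint, hV, rfl, by rwa [LinearIsometryEquiv.norm_map], fun f hf => ?_, ?_, ?_,
    hdef, fun F G hF hG f hf => ?_, fun p _ hp => ?_⟩
  · rw [hsq]
    exact ⟨hae _ _ hinf hdef f hf.1, fun x hx =>
      hpoint _ _ hdef f hf.1 x (infExt_apply_of_mem_closure hs hVU hx)⟩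
  · rw [hadj]
    exact isLinearVersion_of_forall_apply_eq hs hts ht htt hVU
  · rw [hadj]
    exact hinf
  · rw [hadj] at hF
    exact ⟨hae F G hF hG f hf.1, fun x hx => hpoint F G hG f hf.1 x hx⟩
  · obtain ⟨S, hS⟩ := exists_lp_extension hφ hp
    have hS1 : IsLpExtension (boundedBorel X) (ouEvolution U B s t) p (gammaMeasure U B t)
        (gammaMeasure U B s) S := fun f _ hfp =>
      (hS f hfp).trans (.of_forall fun x => (hyp.ouEvolution_eq hst f x).symm)
    -- The almost everywhere identity `hae` needs measurability of `f` only, so the same `S` serves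
    -- functions of exponential growth.
    have hS2 : IsLpExtension (expGrowth X) (secondQuantization V.adjoint) p (gammaMeasure U B t)
        (gammaMeasure U B s) S := fun f hf hfp => by
      rw [hsq]
      exact ((hS f hfp).trans (.of_forall fun x => (hyp.ouEvolution_eq hst f x).symm)).trans
        (hae _ _ hinf hdef f hf.1)
    exact ⟨S, ⟨hS1, fun S' hS' => hS1.eq hp Subset.rfl hS'⟩,
      hS2, fun S' hS' => hS2.eq hp boundedBorel_subset_expGrowth hS'⟩
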